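/- **Setting.** A seller owns one indivisible good. Seller types $x\in X=\{1,\dots,\bar x\}$ and buyer types $y\in Y=\{1,\dots,\bar y\}$ are independent, with full-support priors $p_1,p_2$. The valuation of trader $i$ (seller $i=1$, buyer $i=2$) is $v_i^1(x)+v_i^2(y)\ge 0$, where $v_1^1,v_2^2$ are strictly increasing and $v_1^2,v_2^1$ are weakly increasing. If the good is transferred with probability $q\in[0,1]$ for a payment $t\in\mathbb R$, the seller gets $t+(v_1^1(x)+v_1^2(y))(1-q)$ and the buyer gets $(v_2^1(x)+v_2^2(y))q-t$. An *allocation* is a map $g=(q,t):X\times Y\to[0,1]\times\mathbb R$. Put $$U_1^g(\hat x\mid x)=\sum_{y}p_2(y)\bigl[t(\hat x,y)+(v_1^1(x)+v_1^2(y))(1-q(\hat x,y))\bigr],\qquad U_1^g(x)=U_1^g(x\mid x).$$ **RSW allocation.** An allocation is *safe* if $U_1^g(x)\ge U_1^g(\hat x\mid x)$ for all $x,\hat x$, and, for all $x,y,\hat y$, $(v_2^1(x)+v_2^2(y))q(x,y)-t(x,y)\ge (v_2^1(x)+v_2^2(y))q(x,\hat y)-t(x,\hat y)$ and $(v_2^1(x)+v_2^2(y))q(x,y)-t(x,y)\ge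 0$. An *RSW allocation* is a safe allocation that maximizes $U_1^g(x)$ over all safe allocations $g$ simultaneously for every $x\in X$; its payoff vector $U_1^{g^*}\in\mathbb R^X$ is the *RSW payoff vector*. **Game.** A *mechanism* $G=\langle S_1,S_2,q,t\rangle$ consists of finite nonempty action sets and an outcome function $(q,t):S_1\times S_2\to[0,1]\times\mathbb R$ (an inactive player has a single action); $\mathcal G$ is the set of all mechanisms, with some $\sigma$-algebra. After types are drawn, the seller offers some $G\in\mathcal G$; the buyer rejects, giving $(0,0)$, or accepts, and then both simultaneously choose actions, giving $(q(s_1,s_2),t(s_1,s_2))$. Given $G$ and a buyer belief $\pi_1\in\Delta(X)$, a *sequential equilibrium of the continuation game* consists of acceptance probabilities $\gamma_2(y)$, mixed actions $\sigma_1(\cdot\mid x),\sigma_2(\cdot\mid y)$, and a seller belief $\pi_2\in\Delta(Y)$ after acceptance, such that $\pi_2(y)\propto p_2(y)\gamma_2(y)$ whenever acceptance has positive probability ($\pi_2$ is arbitrary otherwise), every $\sigma_1(\cdot\mid x)$ is optimal given $\pi_2,\sigma_2$, every $\sigma_2(\cdot\mid y)$ is optimal given $\pi_1,\sigma_1$,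 and every $\gamma_2(y)$ is optimal. It induces the allocation $$(q'(x,y),t'(x,y))=\gamma_2(y)\sum_{s_1,s_2}\sigma_1(s_1\mid x)\sigma_2(s_2\mid y)\,(q(s_1,s_2),t(s_1,s_2)).$$ $BR(\pi_1,G)$ is the set of all allocations so induced, and $BR(G)=\bigcup_{\pi_1\in\Delta(X)}BR(\pi_1,G)$. An *equilibrium* consists of probability measures $\gamma_1(x)$ on $\mathcal G$ ($x\in X$) and, for every $G\in\mathcal G$, a belief $\pi_1^G\in\Delta(X)$ and a sequential equilibrium of the continuation game given $(\pi_1^G,G)$, inducing an allocation $g_G$, such that: $G\mapsto\pi_1^G$ is a conditional distribution of $x$ given $G$ when $x\sim p_1$ and $G\sim\gamma_1(x)$; the integrals below exist; and $\int U_1^{g_G}(x)\,d\gamma_1(x)(G)\ge U_1^{g_{G'}}(x)$ for all $x\in X$, $G'\in\mathcal G$. Its *equilibrium allocation* has value $\int g_G(x,y)\,d\gamma_1(x)(G)$ at $(x,y)$. **Intuitive criterion.** Given an equilibrium allocation $g$ and a mechanism $G$, let $X(G)$ be the set of types $x$ such that $U_1^{g'}(x)<U_1^g(x)$ for all $g'\in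 BR(G)$. The allocation $g$ *passes the intuitive criterion* if there are no mechanism $G$ and type $x'\in X\setminus X(G)$ such that $U_1^{g'}(x')>U_1^g(x')$ for every $\pi_1\in\Delta(X\setminus X(G))$ and every $g'\in BR(\pi_1,G)$. **Theorem.** Suppose that $X=\{1,2\}$ or that $v_1^2(y)=0$ for all $y\in Y$. Let $\tilde g$ be an equilibrium allocation that passes the intuitive criterion. Then $U_1^{\tilde g}$ is the RSW payoff vector: an RSW allocation exists, and $U_1^{\tilde g}=U_1^{g^*}$ for every RSW allocation $g^*$. -/

import Mathlib

open MeasureTheory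

namespace InformedSeller

noncomputable section

/-- The trading environment: seller types `X = Fin n`, buyer types `Y = Fin m`, independent
full-support priors `p₁`, `p₂`, and additively separable nonnegative valuations, trader `i` having
valuation `vᵢ₁ x + vᵢ₂ y`. -/
structure Environment (n m : ℕ) where
  p₁ : Fin n → ℝ
  p₂ : Fin m → ℝ
  p₁_pos : ∀ x, 0 < p₁ x
  p₁_sum : ∑ x, p₁ x = 1
  p₂_pos : ∀ y, 0 < p₂ y
  p₂_sum : ∑ y, p₂ y = 1
  v₁₁ : Fin n → ℝ
  v₁₂ : Fin m → ℝ
  v₂₁ : Fin n → ℝ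
  v₂₂ : Fin m → ℝ
  v₁₁_strictMono : StrictMono v₁₁
  v₁₂_mono : Monotone v₁₂
  v₂₁_mono : Monotone v₂₁
  v₂₂_strictMono : StrictMono v₂₂
  v₁_nonneg : ∀ x y, 0 ≤ v₁₁ x + v₁₂ y
  v₂_nonneg : ∀ x y, 0 ≤ v₂₁ x + v₂₂ y

/-- A direct mechanism, also called an allocation: trading probabilities and payments. -/
@[ext]
structure Allocation (n m : ℕ) where
  q : Fin n → Fin m → ℝ
  t : Fin n → Fin m → ℝ
  q_mem : ∀ x y, q x y ∈ Set.Icc (0 : ℝ) 1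

/-- A mechanism: a finite strategic game form. A player who is inactive has exactly one action. -/
structure Mechanism where
  S₁ : Type
  S₂ : Type
  [fintype₁ : Fintype S₁]
  [fintype₂ : Fintype S₂]
  [nonempty₁ : Nonempty S₁]
  [nonempty₂ : Nonempty S₂]
  q : S₁ → S₂ → ℝ
  t : S₁ → S₂ → ℝ
  q_mem : ∀ s₁ s₂, q s₁ s₂ ∈ Set.Icc (0 : ℝ) 1

attribute [instance] Mechanism.fintype₁ Mechanism.fintype₂ Mechanism.nonempty₁ Mechanism.nonempty₂

variable {n m : ℕ}

namespace Environment

variable (E : Environment n m)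

/-- `U₁^g(x̂ ∣ x)`: interim payoff of seller type `x` reporting `x'`. -/
def sellerReport (g : Allocation n m) (x' x : Fin n) : ℝ :=
  ∑ y, E.p₂ y * (g.t x' y + (E.v₁₁ x + E.v₁₂ y) * (1 - g.q x' y))

/-- `U₁^g(x)`: the seller's interim payoff vector under truth-telling. -/
def sellerPayoff (g : Allocation n m) (x : Fin n) : ℝ := E.sellerReport g x x

/-- `u₂^g(ŷ ∣ x, y)`: ex post payoff of buyer type `y` reporting `y'` when the seller is `x`. -/
def buyerReport (g : Allocation n m) (y' : Fin m) (x : Fin n) (y : Fin m) : ℝ :=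
  (E.v₂₁ x + E.v₂₂ y) * g.q x y' - g.t x y'

/-- `g` is Bayesian incentive compatible for the seller. -/
def SellerBIC (g : Allocation n m) : Prop :=
  ∀ x x', E.sellerReport g x' x ≤ E.sellerPayoff g x

/-- `g` is ex post incentive compatible for the buyer. -/
def BuyerEPIC (g : Allocation n m) : Prop :=
  ∀ x y y', E.buyerReport g y' x y ≤ E.buyerReport g y x y

/-- `g` is ex post individually rational for the buyer. -/
def BuyerEPIR (g : Allocation n m) : Prop :=
  ∀ x y, 0 ≤ E.buyerReport g y x y

/-- The constraints of the problems that define an RSW allocation. -/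
def Safe (g : Allocation n m) : Prop :=
  E.SellerBIC g ∧ E.BuyerEPIC g ∧ E.BuyerEPIR g

/-- `g` is a Rothschild--Stiglitz--Wilson allocation: it satisfies the constraints and maximizes
every seller type's interim payoff among all allocations that satisfy them. -/
def IsRSW (g : Allocation n m) : Prop :=
  E.Safe g ∧ ∀ x, ∀ g', E.Safe g' → E.sellerPayoff g' x ≤ E.sellerPayoff g x

end Environment

/-- Behavioral strategies once the mechanism `G` has been offered: acceptance probabilities `γ₂`
of the buyer and mixed actions `σ₁`, `σ₂` of both players after acceptance. -/
structure Profile (n m : ℕ) (G : Mechanism) where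
  γ₂ : Fin m → ℝ
  σ₁ : Fin n → G.S₁ → ℝ
  σ₂ : Fin m → G.S₂ → ℝ
  γ₂_mem : ∀ y, γ₂ y ∈ Set.Icc (0 : ℝ) 1
  σ₁_mem : ∀ x, σ₁ x ∈ stdSimplex ℝ G.S₁
  σ₂_mem : ∀ y, σ₂ y ∈ stdSimplex ℝ G.S₂

namespace Profile

variable {G : Mechanism} (s : Profile n m G)

/-- The allocation induced by a profile; rejection leads to the no-trade outcome `(0, 0)`. -/
def allocation : Allocation n m where
  q x y := s.γ₂ y * ∑ s₁, ∑ s₂, s.σ₁ x s₁ * s.σ₂ y s₂ * G.q s₁ s₂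
  t x y := s.γ₂ y * ∑ s₁, ∑ s₂, s.σ₁ x s₁ * s.σ₂ y s₂ * G.t s₁ s₂
  q_mem x y := by
    have h1 := s.σ₁_mem x
    have h2 := s.σ₂_mem y
    have hw : ∀ a b, 0 ≤ s.σ₁ x a * s.σ₂ y b := fun a b => mul_nonneg (h1.1 a) (h2.1 b)
    have h0 : 0 ≤ ∑ a, ∑ b, s.σ₁ x a * s.σ₂ y b * G.q a b :=
      Finset.sum_nonneg fun a _ => Finset.sum_nonneg fun b _ => mul_nonneg (hw a b) (G.q_mem a b).1
    have hle : ∑ a, ∑ b, s.σ₁ x a * s.σ₂ y b * G.q a b ≤ 1 := by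
      calc ∑ a, ∑ b, s.σ₁ x a * s.σ₂ y b * G.q a b
          ≤ ∑ a, ∑ b, s.σ₁ x a * s.σ₂ y b :=
            Finset.sum_le_sum fun a _ => Finset.sum_le_sum fun b _ =>
              mul_le_of_le_one_right (hw a b) (G.q_mem a b).2
        _ = 1 := by rw [← Finset.sum_mul_sum, h1.2, h2.2, mul_one]
    exact ⟨mul_nonneg (s.γ₂_mem y).1 h0, mul_le_one₀ (s.γ₂_mem y).2 h0 hle⟩

/-- Expected payoff of seller type `x` from action `s₁` after acceptance, under belief `π₂`. -/
def sellerActionPayoff (E : Environment n m) (π₂ : Fin m → ℝ) (x : Fin n) (s₁ : G.S₁) : ℝ :=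
  ∑ y, π₂ y * ∑ s₂, s.σ₂ y s₂ * (G.t s₁ s₂ + (E.v₁₁ x + E.v₁₂ y) * (1 - G.q s₁ s₂))

/-- Expected payoff of buyer type `y` from action `s₂` after acceptance, under belief `π₁`. -/
def buyerActionPayoff (E : Environment n m) (π₁ : Fin n → ℝ) (y : Fin m) (s₂ : G.S₂) : ℝ :=
  ∑ x, π₁ x * ∑ s₁, s.σ₁ x s₁ * ((E.v₂₁ x + E.v₂₂ y) * G.q s₁ s₂ - G.t s₁ s₂)

/-- Expected payoff of buyer type `y` from accepting. -/
def acceptPayoff (E : Environment n m) (π₁ : Fin n → ℝ) (y : Fin m) : ℝ :=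
  ∑ s₂, s.σ₂ y s₂ * s.buyerActionPayoff E π₁ y s₂

/-- `(s, π₂)` is a sequential equilibrium assessment of the continuation game in which `G` has been
offered and the buyer's belief about the seller's type is `π₁`; `π₂` is the seller's belief about
the buyer's type after acceptance. Bayes' rule is written in product form, so that it leaves `π₂`
free exactly when acceptance has probability zero. -/
structure IsSequential (E : Environment n m) (π₁ : Fin n → ℝ) (π₂ : Fin m → ℝ) : Prop where
  belief_mem : π₂ ∈ stdSimplex ℝ (Fin m)
  bayes : ∀ y, π₂ y * ∑ y', E.p₂ y' * s.γ₂ y' = E.p₂ y * s.γ₂ y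
  seller_opt : ∀ x s₁', s.sellerActionPayoff E π₂ x s₁' ≤
    ∑ s₁, s.σ₁ x s₁ * s.sellerActionPayoff E π₂ x s₁
  buyer_opt : ∀ y s₂', s.buyerActionPayoff E π₁ y s₂' ≤ s.acceptPayoff E π₁ y
  accept_opt : ∀ y, ∀ a ∈ Set.Icc (0 : ℝ) 1, a * s.acceptPayoff E π₁ y ≤
    s.γ₂ y * s.acceptPayoff E π₁ y

end Profile

/-- An assessment of the mechanism-selection game: the seller's mechanism-selection plan, the
strategies after every offer, the buyer's beliefs after every offer, and the seller's beliefs after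
every acceptance. -/
structure Assessment (n m : ℕ) [MeasurableSpace Mechanism] where
  γ₁ : Fin n → Measure Mechanism
  prob : ∀ x, IsProbabilityMeasure (γ₁ x)
  cont : ∀ G : Mechanism, Profile n m G
  π₁ : Mechanism → Fin n → ℝ
  π₂ : Mechanism → Fin m → ℝ
  π₁_mem : ∀ G, π₁ G ∈ stdSimplex ℝ (Fin n)

namespace Assessment

variable [MeasurableSpace Mechanism]

/-- The marginal distribution of offers under the prior. -/
def offerLaw (A : Assessment n m) (E : Environment n m) : Measure Mechanism :=
  ∑ x, ENNReal.ofReal (E.p₁ x) • A.γ₁ x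

/-- The assessment is an equilibrium (sequentially rational and consistent).
`bayes`: the buyer's belief is a version of the conditional distribution of the seller's type given
the offer. `integrable_q`, `integrable_t`: the equilibrium allocation is well defined.
`offer_opt`: no seller type gains by offering another mechanism. -/
structure IsEquilibrium (A : Assessment n m) (E : Environment n m) : Prop where
  sequential : ∀ G, (A.cont G).IsSequential E (A.π₁ G) (A.π₂ G)
  measurable_belief : ∀ x, AEMeasurable (fun G => A.π₁ G x) (A.offerLaw E)
  bayes : ∀ x, ENNReal.ofReal (E.p₁ x) • A.γ₁ x =
    (A.offerLaw E).withDensity fun G => ENNReal.ofReal (A.π₁ G x)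
  integrable_q : ∀ x y, Integrable (fun G => (A.cont G).allocation.q x y) (A.γ₁ x)
  integrable_t : ∀ x y, Integrable (fun G => (A.cont G).allocation.t x y) (A.γ₁ x)
  offer_opt : ∀ x G', E.sellerPayoff (A.cont G').allocation x ≤
    ∫ G, E.sellerPayoff (A.cont G).allocation x ∂(A.γ₁ x)

end Assessment

namespace Environment

variable (E : Environment n m)

/-- `g` is the allocation induced by some equilibrium of the mechanism-selection game. -/
def IsEquilibriumAllocation [MeasurableSpace Mechanism] (g : Allocation n m) : Prop :=
  ∃ A : Assessment n m, A.IsEquilibrium E ∧ ∀ x y,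
    g.q x y = ∫ G, (A.cont G).allocation.q x y ∂(A.γ₁ x) ∧
    g.t x y = ∫ G, (A.cont G).allocation.t x y ∂(A.γ₁ x)

/-- `BR(π₁, G)`: sequential equilibrium allocations of the continuation game given `(π₁, G)`. -/
def BR (π₁ : Fin n → ℝ) (G : Mechanism) : Set (Allocation n m) :=
  {g' | ∃ (s : Profile n m G) (π₂ : Fin m → ℝ), s.IsSequential E π₁ π₂ ∧ g' = s.allocation}

/-- `BR(G)`: the union of `BR(π₁, G)` over all beliefs `π₁`. -/
def BRall (G : Mechanism) : Set (Allocation n m) :=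
  ⋃ π₁ ∈ stdSimplex ℝ (Fin n), E.BR π₁ G

/-- `D(x, G)`, given the equilibrium allocation `g`. -/
def D (g : Allocation n m) (x : Fin n) (G : Mechanism) : Set (Allocation n m) :=
  {g' ∈ E.BRall G | E.sellerPayoff g x < E.sellerPayoff g' x}

/-- `D⁰(x, G)`, given the equilibrium allocation `g`. -/
def D₀ (g : Allocation n m) (x : Fin n) (G : Mechanism) : Set (Allocation n m) :=
  {g' ∈ E.BRall G | E.sellerPayoff g' x = E.sellerPayoff g x}

/-- `X(G)`: the seller types that never have a weak incentive to deviate from `g` to `G`. -/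
def excluded (g : Allocation n m) (G : Mechanism) : Set (Fin n) :=
  {x | E.D g x G ∪ E.D₀ g x G = ∅}

/-- `g` passes the intuitive criterion. -/
def PassesIntuitive (g : Allocation n m) : Prop :=
  ¬ ∃ G : Mechanism, ∃ x' ∉ E.excluded g G,
    ∀ π₁ ∈ stdSimplex ℝ (Fin n), (∀ x ∈ E.excluded g G, π₁ x = 0) →
      ∀ g' ∈ E.BR π₁ G, E.sellerPayoff g x' < E.sellerPayoff g' x'

end Environment

end

end InformedSeller

/-!
Since the buyer's beliefs are a conditional distribution, an equilibrium allocation is incentive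
compatible and individually rational at the interim stage for a buyer who holds the prior, besides
being incentive compatible for the seller and giving each type at least the value of keeping the
good.

The intuitive criterion adds the following. Suppose that some type `xs` could gain over her
equilibrium payoff by a mixture of posted prices addressed to a buyer who knows her type, while a
lower type who imitated such a type `xs` at her equilibrium payoff would not gain. Scale the mixture
down until it barely attracts `xs`; then it repels the lower types. It is carried out by a menu
whose shares and prices depend on a report of the seller. A small scoring rule makes the report
strictly dominant, so that the continuation game has essentially one outcome: the lower types lose
whatever the buyer believes, and `xs` gains if the buyer's belief excludes them. This is where the
alternative in the hypothesis enters. Two types can be pooled at one report; for private values of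
the seller, the types above `xs` are separated by the shares of the good that they retain, as in a
signalling game.

By induction on the type, no safe allocation then gives any type more than her equilibrium payoff.
Conversely, the trading probabilities of the equilibrium can be replaced by probabilities that are
monotone in the buyer's type and have the same marginals. With envelope payments they form a safe
allocation, whose expected revenue is at least that of the equilibrium; as no type can gain, no type
loses either.
-/

namespace InformedSeller

open Finset Filter Topology

section Rows

variable {m : ℕ} {v q t : Fin m → ℝ}

/-- The increments `q k - q (k - 1)` of a row, where `q (-1) = 0`. They are the weights of the
mixture of posted prices under which buyer type `y` trades with probability `q y`. -/
def increment (q : Fin m → ℝ) (k : Fin m) : ℝ :=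
  q k - if h : 0 < k.val then q ⟨k.val - 1, by omega⟩ else 0

/-- The expected payment of buyer type `y` under the mixture of posted prices that trades with
probabilities `q`, the price of the `k`-th increment being `v k`. -/
def envelopePayment (v q : Fin m → ℝ) (y : Fin m) : ℝ :=
  ∑ k ∈ Iic y, v k * increment q k

lemma increment_of_val_eq_zero (q : Fin m → ℝ) {k : Fin m} (hk : k.val = 0) :
    increment q k = q k := by
  simp [increment, hk]

lemma increment_of_val_eq_succ (q : Fin m → ℝ) {j k : Fin m} (hk : k.val = j.val + 1) :
    increment q k = q k - q j := by
  simp [increment, hk]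

lemma increment_nonneg (h0 : ∀ y, 0 ≤ q y) (hq : Monotone q) (k : Fin m) :
    0 ≤ increment q k := by
  unfold increment
  split_ifs with h
  · exact sub_nonneg.2 (hq (Fin.le_def.2 (Nat.sub_le _ _)))
  · simpa using h0 k

lemma increment_sum_mul {ι : Type*} [Fintype ι] (c : ι → ℝ) (q : ι → Fin m → ℝ) (k : Fin m) :
    increment (fun y => ∑ x, c x * q x y) k = ∑ x, c x * increment (q x) k := by
  unfold increment
  split_ifs
  · simp only [mul_sub, sum_sub_distrib]
  · simp only [sub_zero]

lemma le_sum_Iic_of_sub_le {f F : Fin m → ℝ} (h0 : ∀ k : Fin m, k.val = 0 → f k ≤ F k)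
    (hs : ∀ j k : Fin m, k.val = j.val + 1 → f k - f j ≤ F k) (y : Fin m) :
    f y ≤ ∑ k ∈ Iic y, F k := by
  obtain ⟨i, hi⟩ := y
  induction i with
  | zero =>
    have hIic : Iic (⟨0, hi⟩ : Fin m) = {⟨0, hi⟩} := by
      ext k; simp only [mem_Iic, mem_singleton, Fin.le_def, Fin.ext_iff]; omega
    rw [hIic, sum_singleton]
    exact h0 _ rfl
  | succ i ih =>
    have hIic : Iic (⟨i + 1, hi⟩ : Fin m) = insert ⟨i + 1, hi⟩ (Iic ⟨i, by omega⟩) := by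
      ext k; simp only [mem_Iic, mem_insert, Fin.le_def, Fin.ext_iff]; omega
    rw [hIic, sum_insert (by simp [Fin.le_def])]
    linarith [ih (by omega), hs ⟨i, by omega⟩ ⟨i + 1, hi⟩ rfl]

lemma sum_Iic_increment (q : Fin m → ℝ) (y : Fin m) : ∑ k ∈ Iic y, increment q k = q y := by
  refine le_antisymm (neg_le_neg_iff.1 ?_) ?_
  · rw [← sum_neg_distrib]
    exact le_sum_Iic_of_sub_le (f := fun k => -q k)
      (fun k hk => by rw [increment_of_val_eq_zero q hk])
      (fun j k hk => by rw [increment_of_val_eq_succ q hk]; linarith) y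
  · exact le_sum_Iic_of_sub_le (fun k hk => (increment_of_val_eq_zero q hk).ge)
      (fun j k hk => (increment_of_val_eq_succ q hk).ge) y

lemma sum_increment_le_one (h1 : ∀ y, q y ≤ 1) : ∑ k, increment q k ≤ 1 := by
  rcases m with _ | m
  · simp
  · have huniv : (univ : Finset (Fin (m + 1))) = Iic (Fin.last m) := by
      ext k; simp [Fin.le_last]
    rw [huniv, sum_Iic_increment]
    exact h1 _

lemma sum_mul_sum_Iic (c F : Fin m → ℝ) :
    ∑ y, c y * ∑ k ∈ Iic y, F k = ∑ k, F k * ∑ y ∈ Ici k, c y := by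
  simp_rw [mul_sum]
  rw [sum_comm' (t' := univ) (s' := fun k => Ici k) (by simp)]
  exact sum_congr rfl fun k _ => sum_congr rfl fun y _ => mul_comm _ _

lemma envelopePayment_const_add (c : ℝ) (v q : Fin m → ℝ) (y : Fin m) :
    envelopePayment (fun k => c + v k) q y = c * q y + envelopePayment v q y := by
  simp only [envelopePayment, add_mul, sum_add_distrib, ← mul_sum, sum_Iic_increment]

lemma envelopePayment_sum_mul {ι : Type*} [Fintype ι] (v : Fin m → ℝ) (c : ι → ℝ)
    (q : ι → Fin m → ℝ) (y : Fin m) :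
    envelopePayment v (fun y => ∑ x, c x * q x y) y = ∑ x, c x * envelopePayment v (q x) y := by
  simp only [envelopePayment, increment_sum_mul, mul_sum]
  rw [sum_comm]
  exact sum_congr rfl fun x _ => sum_congr rfl fun k _ => mul_left_comm _ _ _

lemma monotone_of_incentiveCompatible (hv : StrictMono v)
    (hic : ∀ y y', v y * q y' - t y' ≤ v y * q y - t y) : Monotone q := by
  intro y y' hy
  rcases hy.eq_or_lt with rfl | hlt
  · rfl
  · have hprod : 0 ≤ (v y' - v y) * (q y' - q y) := by linarith [hic y y', hic y' y]
    exact sub_nonneg.1 (nonneg_of_mul_nonneg_right hprod (sub_pos.2 (hv hlt)))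

lemma le_envelopePayment (hic : ∀ y y', v y * q y' - t y' ≤ v y * q y - t y)
    (hir : ∀ y, 0 ≤ v y * q y - t y) (y : Fin m) : t y ≤ envelopePayment v q y := by
  refine le_sum_Iic_of_sub_le (fun k hk => ?_) (fun j k hk => ?_) y
  · rw [increment_of_val_eq_zero q hk]; linarith [hir k]
  · rw [increment_of_val_eq_succ q hk]; linarith [hic k j]

lemma mul_sub_envelopePayment (v q : Fin m → ℝ) (c : ℝ) (y : Fin m) :
    c * q y - envelopePayment v q y = ∑ k ∈ Iic y, (c - v k) * increment q k := by
  simp only [envelopePayment, sub_mul, sum_sub_distrib, ← mul_sum, sum_Iic_increment]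

lemma envelopePayment_incentiveCompatible (hv : Monotone v) (h0 : ∀ y, 0 ≤ q y)
    (hq : Monotone q) (y y' : Fin m) :
    v y * q y' - envelopePayment v q y' ≤ v y * q y - envelopePayment v q y := by
  have hinc := increment_nonneg h0 hq
  simp only [mul_sub_envelopePayment]
  rcases le_total y' y with hle | hle
  · exact sum_le_sum_of_subset_of_nonneg (Iic_subset_Iic.2 hle) fun k hk _ =>
      mul_nonneg (sub_nonneg.2 (hv (mem_Iic.1 hk))) (hinc k)
  · rw [← sum_sdiff (Iic_subset_Iic.2 hle)]
    refine add_le_of_nonpos_left (sum_nonpos fun k hk => ?_)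
    have hk' : y < k := by simpa using (mem_sdiff.1 hk).2
    exact mul_nonpos_of_nonpos_of_nonneg (sub_nonpos.2 (hv hk'.le)) (hinc k)

lemma envelopePayment_le_mul (hv : Monotone v) (h0 : ∀ y, 0 ≤ q y) (hq : Monotone q)
    (y : Fin m) : envelopePayment v q y ≤ v y * q y := by
  rw [← sub_nonneg, mul_sub_envelopePayment]
  exact sum_nonneg fun k hk =>
    mul_nonneg (sub_nonneg.2 (hv (mem_Iic.1 hk))) (increment_nonneg h0 hq k)

end Rows

section WeightedSums

variable {ι : Type*}

-- With `j` the first index where `f` is negative, `h y * f y ≥ h j * f y` for all `y`.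
lemma sum_mul_mul_nonneg_of_antitoneOn [LinearOrder ι] {s : Finset ι} {p f h : ι → ℝ}
    (hp : ∀ y ∈ s, 0 ≤ p y) (hf : AntitoneOn f s) (hh : AntitoneOn h s) (h0 : ∀ y ∈ s, 0 ≤ h y)
    (hsum : 0 ≤ ∑ y ∈ s, p y * f y) : 0 ≤ ∑ y ∈ s, p y * (h y * f y) := by
  rcases (s.filter fun y => f y < 0).eq_empty_or_nonempty with hnone | hne
  · have hpos : ∀ y ∈ s, 0 ≤ f y := by simpa [filter_eq_empty_iff] using hnone
    exact sum_nonneg fun y hy => mul_nonneg (hp y hy) (mul_nonneg (h0 y hy) (hpos y hy))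
  · set j := (s.filter fun y => f y < 0).min' hne
    obtain ⟨hjs, hfj⟩ : j ∈ s ∧ f j < 0 := by simpa using min'_mem _ hne
    have hterm : ∀ y ∈ s, h j * f y ≤ h y * f y := fun y hy => by
      rcases lt_or_ge y j with hlt | hge
      · have hfy : 0 ≤ f y := not_lt.1 fun hc => (min'_le _ y (by simp [hy, hc])).not_gt hlt
        exact mul_le_mul_of_nonneg_right (hh hy hjs hlt.le) hfy
      · exact mul_le_mul_of_nonpos_right (hh hjs hy hge) ((hf hjs hy hge).trans hfj.le)
    calc (0 : ℝ) ≤ h j * ∑ y ∈ s, p y * f y := mul_nonneg (h0 j hjs) hsum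
      _ = ∑ y ∈ s, p y * (h j * f y) := by
        rw [mul_sum]; exact sum_congr rfl fun y _ => mul_left_comm _ _ _
      _ ≤ _ := sum_le_sum fun y hy => mul_le_mul_of_nonneg_left (hterm y hy) (hp y hy)

variable [Fintype ι] {σ f : ι → ℝ}

lemma sum_mul_pos_of_mem_stdSimplex (hσ : σ ∈ stdSimplex ℝ ι) (hf : ∀ i, σ i ≠ 0 → 0 < f i) :
    0 < ∑ i, σ i * f i := by
  obtain ⟨i, -, hi⟩ : ∃ i ∈ univ, σ i ≠ 0 :=
    exists_ne_zero_of_sum_ne_zero (by rw [hσ.2]; exact one_ne_zero)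
  have hpos : ∀ j, σ j ≠ 0 → 0 < σ j * f j := fun j hj =>
    mul_pos ((hσ.1 j).lt_of_ne' hj) (hf j hj)
  refine sum_pos' (fun j _ => ?_) ⟨i, mem_univ i, hpos i hi⟩
  rcases eq_or_ne (σ j) 0 with hj | hj
  · rw [hj, zero_mul]
  · exact (hpos j hj).le

lemma sum_mul_const_of_mem_stdSimplex (hσ : σ ∈ stdSimplex ℝ ι) (c : ℝ) :
    ∑ i, σ i * c = c := by
  rw [← sum_mul, hσ.2, one_mul]

lemma eq_sum_mul_of_forall_le (hσ : σ ∈ stdSimplex ℝ ι) (h : ∀ j, f j ≤ ∑ i, σ i * f i)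
    {i : ι} (hi : σ i ≠ 0) : f i = ∑ j, σ j * f j := by
  have hzero : ∑ j, σ j * (∑ i, σ i * f i - f j) = 0 := by
    simp only [mul_sub, sum_sub_distrib, sum_mul_const_of_mem_stdSimplex hσ, sub_self]
  have hterm := (sum_eq_zero_iff_of_nonneg fun j _ =>
    mul_nonneg (hσ.1 j) (sub_nonneg.2 (h j))).1 hzero i (mem_univ i)
  exact (sub_eq_zero.1 ((mul_eq_zero.1 hterm).resolve_left hi)).symm

lemma eq_single_of_mem_stdSimplex [DecidableEq ι] (hσ : σ ∈ stdSimplex ℝ ι) {i : ι}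
    (h : ∀ j, j ≠ i → σ j = 0) : σ = Pi.single i 1 := by
  have hi : σ i = 1 := by rw [← hσ.2, sum_eq_single i (fun j _ hj => h j hj) (by simp)]
  funext j
  rcases eq_or_ne j i with rfl | hj
  · rw [hi, Pi.single_eq_same]
  · rw [h j hj, Pi.single_eq_of_ne hj]

lemma sum_single_one_mul [DecidableEq ι] (i : ι) (f : ι → ℝ) :
    ∑ j, (Pi.single i 1 : ι → ℝ) j * f j = f i := by
  simp [Pi.single_apply]

end WeightedSums

section MonotoneRearrangement

variable {ι κ : Type*} {p f p₂ : κ → ℝ} {p₁ : ι → ℝ} {r : ι → κ → ℝ}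

section MassTransfer

variable [DecidableEq κ]

/-- The direction that moves one unit of `p`-weighted mass from `j` to `i`. -/
noncomputable def massTransfer (p : κ → ℝ) (i j : κ) : κ → ℝ :=
  Pi.single i (p i)⁻¹ - Pi.single j (p j)⁻¹

lemma add_massTransfer_mem_Icc (hp : ∀ k, 0 < p k) {i j : κ} {c : ℝ} (hc : 0 ≤ c)
    (hf : ∀ k, f k ∈ Set.Icc (0 : ℝ) 1) (hle : c * ((p i)⁻¹ + (p j)⁻¹) ≤ f j - f i) (k : κ) :
    f k + c * massTransfer p i j k ∈ Set.Icc (0 : ℝ) 1 := by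
  have hi : 0 ≤ c * (p i)⁻¹ := mul_nonneg hc (inv_pos.2 (hp i)).le
  have hj : 0 ≤ c * (p j)⁻¹ := mul_nonneg hc (inv_pos.2 (hp j)).le
  have hfi := hf i
  have hfj := hf j
  have hfk := hf k
  simp only [Set.mem_Icc, massTransfer, Pi.sub_apply, Pi.single_apply] at *
  split_ifs with h₁ h₂ h₂ <;> subst_vars <;> constructor <;> linarith

variable [Fintype κ]

lemma sum_mul_massTransfer_mul (hp : ∀ k, 0 < p k) (i j : κ) (f : κ → ℝ) :
    ∑ k, p k * (massTransfer p i j k * f k) = f i - f j := by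
  simp only [massTransfer, Pi.sub_apply, sub_mul, mul_sub, sum_sub_distrib, Pi.single_apply,
    ite_mul, zero_mul, mul_ite, mul_zero, sum_ite_eq', mem_univ, if_true]
  rw [mul_inv_cancel_left₀ (hp i).ne', mul_inv_cancel_left₀ (hp j).ne']

lemma sum_mul_add_massTransfer (hp : ∀ k, 0 < p k) (i j : κ) (f : κ → ℝ) (c : ℝ) :
    ∑ k, p k * (f k + c * massTransfer p i j k) = ∑ k, p k * f k := by
  have hzero := sum_mul_massTransfer_mul hp i j fun _ => c
  rw [sub_self] at hzero
  rw [← add_zero (∑ k, p k * f k), ← hzero, ← sum_add_distrib]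
  exact sum_congr rfl fun k _ => by ring

lemma sum_mul_add_massTransfer_sq_le (hp : ∀ k, 0 < p k) {i j : κ} (hij : i ≠ j) {c : ℝ}
    (hc : 0 ≤ c) (hle : c * ((p i)⁻¹ + (p j)⁻¹) ≤ f j - f i) :
    ∑ k, p k * (f k + c * massTransfer p i j k) ^ 2 ≤
      ∑ k, p k * f k ^ 2 - c * (f j - f i) := by
  have hexpand : ∑ k, p k * (f k + c * massTransfer p i j k) ^ 2 =
      ∑ k, p k * f k ^ 2 +
        ∑ k, p k * (massTransfer p i j k * (2 * c * f k + c ^ 2 * massTransfer p i j k)) := by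
    rw [← sum_add_distrib]
    exact sum_congr rfl fun k _ => by ring
  have hi : massTransfer p i j i = (p i)⁻¹ := by simp [massTransfer, hij]
  have hj : massTransfer p i j j = -(p j)⁻¹ := by simp [massTransfer, hij.symm]
  rw [hexpand, sum_mul_massTransfer_mul hp, hi, hj]
  linarith [mul_le_mul_of_nonneg_left hle hc]

end MassTransfer

lemma exists_pos_mul_le_and_mul_le {a b d e : ℝ} (ha : 0 < a) (hb : 0 < b) (hd : 0 < d)
    (he : 0 < e) : ∃ c > 0, c * a ≤ d ∧ c * b ≤ e :=
  ⟨min (d / a) (e / b), lt_min (div_pos hd ha) (div_pos he hb),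
    (le_div_iff₀ ha).1 (min_le_left _ _), (le_div_iff₀ hb).1 (min_le_right _ _)⟩

variable [Fintype ι] [Fintype κ]

lemma exists_transfer_sum_sq_lt (hp₁ : ∀ x, 0 < p₁ x) (hp₂ : ∀ y, 0 < p₂ y)
    (hr : ∀ x y, r x y ∈ Set.Icc (0 : ℝ) 1) {x x' : ι} {y y' : κ} (hx : r x y' < r x y)
    (hx' : r x' y < r x' y') :
    ∃ r' : ι → κ → ℝ, (∀ x y, r' x y ∈ Set.Icc (0 : ℝ) 1) ∧
      (∀ x, ∑ y, p₂ y * r' x y = ∑ y, p₂ y * r x y) ∧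
      (∀ y, ∑ x, p₁ x * r' x y = ∑ x, p₁ x * r x y) ∧
      ∑ x, p₁ x * ∑ y, p₂ y * r' x y ^ 2 < ∑ x, p₁ x * ∑ y, p₂ y * r x y ^ 2 := by
  classical
  have hy : y' ≠ y := by rintro rfl; exact hx.false
  have hxx : x ≠ x' := by rintro rfl; exact hx.asymm hx'
  have hpos : ∀ i j j', 0 < (p₁ i)⁻¹ * ((p₂ j)⁻¹ + (p₂ j')⁻¹) := fun i j j' =>
    mul_pos (inv_pos.2 (hp₁ i)) (add_pos (inv_pos.2 (hp₂ j)) (inv_pos.2 (hp₂ j')))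
  obtain ⟨c, hc, hcx, hcx'⟩ := exists_pos_mul_le_and_mul_le (hpos x y' y) (hpos x' y y')
    (sub_pos.2 hx) (sub_pos.2 hx')
  rw [← mul_assoc] at hcx hcx'
  have hposx : 0 < c * (p₁ x)⁻¹ := mul_pos hc (inv_pos.2 (hp₁ x))
  have hposx' : 0 < c * (p₁ x')⁻¹ := mul_pos hc (inv_pos.2 (hp₁ x'))
  set r' : ι → κ → ℝ := fun i j =>
    r i j + c * massTransfer p₁ x x' i * massTransfer p₂ y' y j with hr'
  have hrow : ∀ j, r' x j = r x j + c * (p₁ x)⁻¹ * massTransfer p₂ y' y j := fun j => by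
    simp [hr', massTransfer, hxx]
  have hrow' : ∀ j, r' x' j = r x' j + c * (p₁ x')⁻¹ * massTransfer p₂ y y' j := fun j => by
    simp only [hr', massTransfer, Pi.sub_apply, Pi.single_eq_same, Pi.single_eq_of_ne hxx.symm]
    ring
  have hother : ∀ i, i ≠ x → i ≠ x' → r' i = r i := fun i h h' => by
    funext j; simp [hr', massTransfer, h, h']
  refine ⟨r', fun i j => ?_, fun i => sum_mul_add_massTransfer hp₂ _ _ _ _, fun j => ?_, ?_⟩
  · rcases eq_or_ne i x with rfl | h
    · rw [hrow]; exact add_massTransfer_mem_Icc hp₂ hposx.le (hr i) hcx j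
    rcases eq_or_ne i x' with rfl | h'
    · rw [hrow']; exact add_massTransfer_mem_Icc hp₂ hposx'.le (hr i) hcx' j
    · rw [hother i h h']; exact hr i j
  · simp only [hr', mul_right_comm c _ (massTransfer p₂ y' y j)]
    exact sum_mul_add_massTransfer hp₁ x x' (fun i => r i j) _
  · have hlt : ∑ j, p₂ j * r' x j ^ 2 < ∑ j, p₂ j * r x j ^ 2 := by
      simp only [hrow]
      exact (sum_mul_add_massTransfer_sq_le hp₂ hy hposx.le hcx).trans_lt
        (sub_lt_self _ (mul_pos hposx (sub_pos.2 hx)))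
    refine sum_lt_sum (fun i _ => mul_le_mul_of_nonneg_left ?_ (hp₁ i).le)
      ⟨x, mem_univ x, mul_lt_mul_of_pos_left hlt (hp₁ x)⟩
    rcases eq_or_ne i x with rfl | h
    · exact hlt.le
    rcases eq_or_ne i x' with rfl | h'
    · simp only [hrow']
      exact (sum_mul_add_massTransfer_sq_le hp₂ hy.symm hposx'.le hcx').trans
        (sub_le_self _ (mul_nonneg hposx'.le (sub_nonneg.2 hx'.le)))
    · rw [hother i h h']

-- Minimising the weighted sum of squares over all matrices with the given marginals: a descent
-- in one row forces an ascent in another, and then a transfer lowers the objective.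
theorem exists_monotone_rows [Preorder κ] (hp₁ : ∀ x, 0 < p₁ x) (hp₂ : ∀ y, 0 < p₂ y)
    {q : ι → κ → ℝ} (hq : ∀ x y, q x y ∈ Set.Icc (0 : ℝ) 1)
    (hmono : Monotone fun y => ∑ x, p₁ x * q x y) :
    ∃ q' : ι → κ → ℝ, (∀ x y, q' x y ∈ Set.Icc (0 : ℝ) 1) ∧
      (∀ x, ∑ y, p₂ y * q' x y = ∑ y, p₂ y * q x y) ∧
      (∀ y, ∑ x, p₁ x * q' x y = ∑ x, p₁ x * q x y) ∧ ∀ x, Monotone (q' x) := by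
  let K : Set (ι → κ → ℝ) :=
    (Set.univ.pi fun _ => Set.univ.pi fun _ => Set.Icc (0 : ℝ) 1) ∩
      {r | (∀ x, ∑ y, p₂ y * r x y = ∑ y, p₂ y * q x y) ∧
        ∀ y, ∑ x, p₁ x * r x y = ∑ x, p₁ x * q x y}
  have hK : IsCompact K := by
    refine (isCompact_univ_pi fun _ => isCompact_univ_pi fun _ => isCompact_Icc).inter_right ?_
    simp only [Set.ofPred_and, Set.ofPred_forall]
    exact (isClosed_iInter fun x => isClosed_eq (by fun_prop) (by fun_prop)).inter
      (isClosed_iInter fun y => isClosed_eq (by fun_prop) (by fun_prop))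
  obtain ⟨r, ⟨hbox, hrow, hcol⟩, hmin⟩ :=
    hK.exists_isMinOn ⟨q, fun x _ y _ => hq x y, fun _ => rfl, fun _ => rfl⟩
      (f := fun r : ι → κ → ℝ => ∑ x, p₁ x * ∑ y, p₂ y * r x y ^ 2)
      (Continuous.continuousOn (by fun_prop))
  have hr : ∀ x y, r x y ∈ Set.Icc (0 : ℝ) 1 := fun x y => hbox x trivial y trivial
  refine ⟨r, hr, hrow, hcol, fun x y y' hyy => not_lt.1 fun hlt => ?_⟩
  obtain ⟨x', hx'⟩ : ∃ x', r x' y < r x' y' := by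
    by_contra! hall
    have hle : ∑ x, p₁ x * r x y ≤ ∑ x, p₁ x * r x y' := by
      rw [hcol, hcol]; exact hmono hyy
    exact hle.not_gt (sum_lt_sum (fun i _ => mul_le_mul_of_nonneg_left (hall i) (hp₁ i).le)
      ⟨x, mem_univ x, mul_lt_mul_of_pos_left hlt (hp₁ x)⟩)
  obtain ⟨r', hr', hrow', hcol', hdecr⟩ := exists_transfer_sum_sq_lt hp₁ hp₂ hr hlt hx'
  have hr'K : r' ∈ K := ⟨fun x _ y _ => hr' x y, fun x => (hrow' x).trans (hrow x),
    fun y => (hcol' y).trans (hcol y)⟩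
  exact (hmin hr'K).not_gt hdecr

end MonotoneRearrangement

section RetentionShares

/-- The shares that sellers with the increasing costs `V` retain when they sell at the increasing
prices `M`: the share of type `j + 1` leaves type `j` indifferent to imitating it. -/
noncomputable def retentionShare (M V : ℕ → ℝ) : ℕ → ℝ
  | 0 => 1
  | j + 1 => if M (j + 1) < V (j + 1) then 0
      else retentionShare M V j * (M j - V j) / (M (j + 1) - V j)

variable {M V : ℕ → ℝ}

lemma retentionShare_succ_of_lt {j : ℕ} (h : M (j + 1) < V (j + 1)) :
    retentionShare M V (j + 1) = 0 := by
  rw [retentionShare, if_pos h]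

lemma retentionShare_nonneg (hV : Monotone V) (h0 : V 0 ≤ M 0) (j : ℕ) :
    0 ≤ retentionShare M V j ∧ 0 ≤ retentionShare M V j * (M j - V j) := by
  induction j with
  | zero => simpa [retentionShare] using h0
  | succ j ih =>
    rcases lt_or_ge (M (j + 1)) (V (j + 1)) with h | h
    · simp [retentionShare_succ_of_lt h]
    · have hshare : 0 ≤ retentionShare M V (j + 1) := by
        rw [retentionShare, if_neg h.not_gt]
        exact div_nonneg ih.2 (by linarith [hV j.le_succ])
      exact ⟨hshare, mul_nonneg hshare (sub_nonneg.2 h)⟩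

lemma retentionShare_succ_mul (hM : Monotone M) (hV : Monotone V) (h0 : V 0 ≤ M 0) {j : ℕ}
    (h : V (j + 1) ≤ M (j + 1)) :
    retentionShare M V (j + 1) * (M (j + 1) - V j) = retentionShare M V j * (M j - V j) := by
  rw [retentionShare, if_neg h.not_gt]
  rcases eq_or_ne (M (j + 1) - V j) 0 with hden | hden
  · have hshare := retentionShare_nonneg hV h0 j
    have hgain : M j - V j ≤ 0 := by linarith [hM j.le_succ]
    rw [hden, mul_zero]
    exact hshare.2.antisymm (mul_nonpos_of_nonneg_of_nonpos hshare.1 hgain)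
  · exact div_mul_cancel₀ _ hden

lemma retentionShare_antitone (hM : Monotone M) (hV : Monotone V) (h0 : V 0 ≤ M 0) :
    Antitone (retentionShare M V) := by
  refine antitone_nat_of_succ_le fun j => ?_
  have hshare := (retentionShare_nonneg hV h0 j).1
  rcases lt_or_ge (M (j + 1)) (V (j + 1)) with h | h
  · rwa [retentionShare_succ_of_lt h]
  · rw [retentionShare, if_neg h.not_gt]
    refine div_le_of_le_mul₀ (by linarith [hV j.le_succ]) hshare ?_
    exact mul_le_mul_of_nonneg_left (by linarith [hM j.le_succ]) hshare

lemma retentionShare_mul_le_succ (hM : Monotone M) (hV : Monotone V) (h0 : V 0 ≤ M 0) {j : ℕ}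
    {v : ℝ} (hv : V (j + 1) ≤ v) :
    retentionShare M V j * (M j - v) ≤ retentionShare M V (j + 1) * (M (j + 1) - v) := by
  rcases lt_or_ge (M (j + 1)) (V (j + 1)) with h | h
  · rw [retentionShare_succ_of_lt h, zero_mul]
    exact mul_nonpos_of_nonneg_of_nonpos (retentionShare_nonneg hV h0 j).1
      (by linarith [hM j.le_succ])
  · have hcost := mul_le_mul_of_nonneg_right (retentionShare_antitone hM hV h0 j.le_succ)
      (sub_nonneg.2 ((hV j.le_succ).trans hv))
    linarith [retentionShare_succ_mul hM hV h0 h]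

lemma retentionShare_succ_mul_le (hM : Monotone M) (hV : Monotone V) (h0 : V 0 ≤ M 0) {j : ℕ}
    {v : ℝ} (hv : v ≤ V j) :
    retentionShare M V (j + 1) * (M (j + 1) - v) ≤ retentionShare M V j * (M j - v) := by
  have hshare := retentionShare_nonneg hV h0 j
  rcases lt_or_ge (M (j + 1)) (V (j + 1)) with h | h
  · rw [retentionShare_succ_of_lt h, zero_mul]
    linarith [mul_nonneg hshare.1 (sub_nonneg.2 hv)]
  · have hcost := mul_le_mul_of_nonneg_right (retentionShare_antitone hM hV h0 j.le_succ)
      (sub_nonneg.2 hv)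
    linarith [retentionShare_succ_mul hM hV h0 h]

lemma retentionShare_optimal (hM : Monotone M) (hV : Monotone V) (h0 : V 0 ≤ M 0) {i : ℕ} {v : ℝ}
    (hlo : i ≠ 0 → V i ≤ v) (hhi : v ≤ V i) (j : ℕ) :
    retentionShare M V j * (M j - v) ≤ retentionShare M V i * (M i - v) := by
  rcases le_total j i with hji | hij
  · refine Nat.decreasingInduction' (fun k hk _ ih => ?_) hji le_rfl
    exact (retentionShare_mul_le_succ hM hV h0 ((hV hk).trans (hlo (by omega)))).trans ih
  · induction j, hij using Nat.le_induction with
    | base => rfl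
    | succ j hj ih => exact (retentionShare_succ_mul_le hM hV h0 (hhi.trans (hV hj))).trans ih

lemma exists_retentionShares {n : ℕ} {M V : Fin n → ℝ} (hM : Monotone M) (hV : Monotone V)
    {s : Fin n} (h0 : V s ≤ M s) :
    ∃ ϑ : Fin n → ℝ, (∀ a, ϑ a ∈ Set.Icc (0 : ℝ) 1) ∧ ϑ s = 1 ∧ ∀ x a, s ≤ a →
      ϑ a * (M a - V x) ≤ ϑ (max x s) * (M (max x s) - V x) := by
  let shift : ℕ → Fin n := fun j => ⟨min (s.val + j) (n - 1), by have := s.pos; omega⟩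
  have hshift : Monotone shift := fun i j hij => by
    simp only [shift, Fin.mk_le_mk]; omega
  have hinv : ∀ a, s ≤ a → shift (a.val - s.val) = a := fun a ha => by
    have := Fin.le_def.1 ha
    ext; simp only [shift]; omega
  have hzero : shift 0 = s := by simpa using hinv s le_rfl
  have hM' : Monotone (M ∘ shift) := hM.comp hshift
  have hV' : Monotone (V ∘ shift) := hV.comp hshift
  have h0' : (V ∘ shift) 0 ≤ (M ∘ shift) 0 := by simpa [hzero] using h0
  refine ⟨fun a => retentionShare (M ∘ shift) (V ∘ shift) (a.val - s.val), fun a =>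
    ⟨(retentionShare_nonneg hV' h0' _).1, ?_⟩, by simp [retentionShare], fun x a ha => ?_⟩
  · simpa [retentionShare] using retentionShare_antitone hM' hV' h0' (Nat.zero_le (a.val - s.val))
  · have hmax := hinv (max x s) (le_max_right x s)
    have hopt := retentionShare_optimal (i := (max x s).val - s.val) (v := V x) hM' hV' h0'
      (fun hne => ?_) ?_ (a.val - s.val)
    · simpa only [Function.comp_apply, hmax, hinv a ha] using hopt
    · have hsx : s ≤ x := le_of_not_gt fun hlt => hne (by simp [max_eq_right hlt.le])
      simp [hinv x hsx, max_eq_left hsx]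
    · simpa only [Function.comp_apply, hmax] using hV (le_max_left x s)

end RetentionShares

namespace Environment

variable {n m : ℕ} (E : Environment n m)

/-- The interim payoff of a seller who never trades. -/
def keepPayoff (x : Fin n) : ℝ := ∑ y, E.p₂ y * (E.v₁₁ x + E.v₁₂ y)

/-- The expected quantity traded at the trading probabilities `q`. -/
def quantity (q : Fin m → ℝ) : ℝ := ∑ y, E.p₂ y * q y

/-- The expected payment, net of the part of the seller's opportunity cost that depends on the
buyer's type. -/
def netRevenue (q t : Fin m → ℝ) : ℝ := ∑ y, E.p₂ y * (t y - E.v₁₂ y * q y)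

/-- Interim incentive compatibility for a buyer who holds the belief `π` about the seller. -/
def BuyerBIC (π : Fin n → ℝ) (g : Allocation n m) : Prop :=
  ∀ y y', ∑ x, π x * E.buyerReport g y' x y ≤ ∑ x, π x * E.buyerReport g y x y

/-- Interim individual rationality for a buyer who holds the belief `π` about the seller. -/
def BuyerBIR (π : Fin n → ℝ) (g : Allocation n m) : Prop :=
  ∀ y, 0 ≤ ∑ x, π x * E.buyerReport g y x y

/-- No seller type gains over the payoffs `u` by a mixture of posted prices addressed to a buyer who
knows the type, provided that at this mixture she would not be imitated by a lower type. This is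
the implication of the intuitive criterion on which the comparison with safe allocations rests. -/
def PostedPriceProof (u : Fin n → ℝ) : Prop :=
  ∀ x (q : Fin m → ℝ), (∀ y, q y ∈ Set.Icc (0 : ℝ) 1) → Monotone q →
    (∀ x' < x, u x - E.keepPayoff x + (E.v₁₁ x - E.v₁₁ x') * E.quantity q ≤
      u x' - E.keepPayoff x') →
    E.netRevenue q (envelopePayment (fun k => E.v₂₁ x + E.v₂₂ k) q) - E.v₁₁ x * E.quantity q ≤
      u x - E.keepPayoff x

lemma keepPayoff_sub (x x' : Fin n) : E.keepPayoff x - E.keepPayoff x' = E.v₁₁ x - E.v₁₁ x' := by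
  rw [keepPayoff, keepPayoff, ← sum_sub_distrib]
  simp only [← mul_sub, add_sub_add_right_eq_sub]
  rw [← sum_mul, E.p₂_sum, one_mul]

lemma valuation_strictMono (x : Fin n) : StrictMono fun y => E.v₂₁ x + E.v₂₂ y :=
  E.v₂₂_strictMono.const_add _

variable {E}

lemma netRevenue_mono {q t t' : Fin m → ℝ} (h : ∀ y, t y ≤ t' y) :
    E.netRevenue q t ≤ E.netRevenue q t' :=
  sum_le_sum fun y _ => mul_le_mul_of_nonneg_left (sub_le_sub_right (h y) _) (E.p₂_pos y).le

lemma sellerReport_eq (g : Allocation n m) (x' x : Fin n) :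
    E.sellerReport g x' x =
      E.keepPayoff x + E.netRevenue (g.q x') (g.t x') - E.v₁₁ x * E.quantity (g.q x') := by
  simp only [sellerReport, keepPayoff, netRevenue, quantity, mul_sum, ← sum_add_distrib,
    ← sum_sub_distrib]
  exact sum_congr rfl fun y _ => by ring

lemma sellerPayoff_eq (g : Allocation n m) (x : Fin n) :
    E.sellerPayoff g x =
      E.keepPayoff x + E.netRevenue (g.q x) (g.t x) - E.v₁₁ x * E.quantity (g.q x) :=
  sellerReport_eq g x x

lemma SellerBIC.sub_add_mul_quantity_le {g : Allocation n m} (h : E.SellerBIC g) (x x' : Fin n) :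
    E.sellerPayoff g x - E.keepPayoff x + (E.v₁₁ x - E.v₁₁ x') * E.quantity (g.q x) ≤
      E.sellerPayoff g x' - E.keepPayoff x' := by
  have himitate := h x' x
  rw [sellerReport_eq] at himitate
  linarith [sellerPayoff_eq (E := E) g x]

lemma sum_mul_netRevenue (q τ : Fin n → Fin m → ℝ) :
    ∑ x, E.p₁ x * E.netRevenue (q x) (fun y => E.v₂₁ x * q x y + τ x y) =
      ∑ x, E.p₁ x * (E.v₂₁ x * E.quantity (q x)) +
        E.netRevenue (fun y => ∑ x, E.p₁ x * q x y) fun y => ∑ x, E.p₁ x * τ x y := by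
  simp only [netRevenue, quantity, mul_sum, ← sum_sub_distrib]
  rw [sum_comm (s := univ (α := Fin m)), ← sum_add_distrib]
  refine sum_congr rfl fun x _ => ?_
  rw [← sum_add_distrib]
  exact sum_congr rfl fun y _ => by ring

lemma sum_mul_buyerReport (g : Allocation n m) (y' y : Fin m) :
    ∑ x, E.p₁ x * E.buyerReport g y' x y = E.v₂₂ y * ∑ x, E.p₁ x * g.q x y' -
      ∑ x, E.p₁ x * (g.t x y' - E.v₂₁ x * g.q x y') := by
  simp only [buyerReport, mul_sum, ← sum_sub_distrib]
  exact sum_congr rfl fun x _ => by ring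

lemma BuyerBIC.monotone {g : Allocation n m} (h : E.BuyerBIC E.p₁ g) :
    Monotone fun y => ∑ x, E.p₁ x * g.q x y :=
  monotone_of_incentiveCompatible E.v₂₂_strictMono fun y y' => by
    simpa only [sum_mul_buyerReport] using h y y'

lemma sum_mul_payment_le_envelopePayment {g : Allocation n m} (hic : E.BuyerBIC E.p₁ g)
    (hir : E.BuyerBIR E.p₁ g) (y : Fin m) :
    ∑ x, E.p₁ x * (g.t x y - E.v₂₁ x * g.q x y) ≤
      envelopePayment E.v₂₂ (fun y => ∑ x, E.p₁ x * g.q x y) y := by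
  simp only [BuyerBIC, BuyerBIR, sum_mul_buyerReport] at hic hir
  exact le_envelopePayment (t := fun y => ∑ x, E.p₁ x * (g.t x y - E.v₂₁ x * g.q x y)) hic hir y

variable (E) in
/-- The allocation with trading probabilities `q` in which every seller type collects the envelope
payments of a buyer who knows her type. -/
def envelopeAllocation (q : Fin n → Fin m → ℝ) (hq : ∀ x y, q x y ∈ Set.Icc (0 : ℝ) 1) :
    Allocation n m where
  q := q
  t x := envelopePayment (fun k => E.v₂₁ x + E.v₂₂ k) (q x)
  q_mem := hq

lemma sum_mul_netRevenue_le {g : Allocation n m} (hic : E.BuyerBIC E.p₁ g) (hir : E.BuyerBIR E.p₁ g)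
    {q : Fin n → Fin m → ℝ} (hrow : ∀ x, E.quantity (q x) = E.quantity (g.q x))
    (hcol : ∀ y, ∑ x, E.p₁ x * q x y = ∑ x, E.p₁ x * g.q x y) :
    ∑ x, E.p₁ x * E.netRevenue (g.q x) (g.t x) ≤
      ∑ x, E.p₁ x * E.netRevenue (q x) (envelopePayment (fun k => E.v₂₁ x + E.v₂₂ k) (q x)) := by
  have hsplit : ∀ x, E.netRevenue (g.q x) (g.t x) = E.netRevenue (g.q x)
      fun y => E.v₂₁ x * g.q x y + (g.t x y - E.v₂₁ x * g.q x y) := fun x => by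
    simp only [add_sub_cancel]
  have hsplit' : ∀ x, E.netRevenue (q x) (envelopePayment (fun k => E.v₂₁ x + E.v₂₂ k) (q x)) =
      E.netRevenue (q x) fun y => E.v₂₁ x * q x y + envelopePayment E.v₂₂ (q x) y := fun x => by
    simp only [← envelopePayment_const_add]
  simp only [hsplit, hsplit', sum_mul_netRevenue, ← envelopePayment_sum_mul, hrow, hcol]
  exact add_le_add le_rfl (netRevenue_mono (sum_mul_payment_le_envelopePayment hic hir))

lemma envelopeAllocation_safe {q : Fin n → Fin m → ℝ} (hq : ∀ x y, q x y ∈ Set.Icc (0 : ℝ) 1)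
    (hmono : ∀ x, Monotone (q x)) (hs : E.SellerBIC (E.envelopeAllocation q hq)) :
    E.Safe (E.envelopeAllocation q hq) :=
  ⟨hs, fun x y y' => envelopePayment_incentiveCompatible (E.valuation_strictMono x).monotone
    (fun y => (hq x y).1) (hmono x) y y', fun x y => sub_nonneg.2 <|
      envelopePayment_le_mul (E.valuation_strictMono x).monotone (fun y => (hq x y).1) (hmono x) y⟩

lemma PostedPriceProof.sellerPayoff_le_of_safe {u : Fin n → ℝ} (hu : E.PostedPriceProof u)
    {g : Allocation n m} (hg : E.Safe g) (x : Fin n) : E.sellerPayoff g x ≤ u x := by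
  obtain ⟨hbic, hic, hir⟩ := hg
  induction x using WellFoundedLT.induction with
  | ind x ih =>
    by_contra! hlt
    have hpay := netRevenue_mono (E := E) (q := g.q x) (le_envelopePayment (hic x) (hir x))
    have hbound := hu x (g.q x) (g.q_mem x)
      (monotone_of_incentiveCompatible (E.valuation_strictMono x) (hic x)) fun x' hx' => by
        linarith [hbic.sub_add_mul_quantity_le x x', ih x' hx']
    linarith [sellerPayoff_eq (E := E) g x]

-- Passing to envelope payments cannot raise any row's revenue, by `hu`, nor lower the expected
-- revenue, by the buyer's constraints; hence it preserves the revenue of every row.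
lemma PostedPriceProof.exists_safe {g : Allocation n m}
    (hu : E.PostedPriceProof (E.sellerPayoff g)) (hs : E.SellerBIC g)
    (hic : E.BuyerBIC E.p₁ g) (hir : E.BuyerBIR E.p₁ g) :
    ∃ gs : Allocation n m, E.Safe gs ∧ E.sellerPayoff gs = E.sellerPayoff g := by
  obtain ⟨q, hq, hrow, hcol, hmono⟩ :=
    exists_monotone_rows E.p₁_pos E.p₂_pos g.q_mem hic.monotone
  have hquantity : ∀ x, E.quantity (q x) = E.quantity (g.q x) := hrow
  set gs := E.envelopeAllocation q hq
  have hle : ∀ x, E.p₁ x * E.netRevenue (gs.q x) (gs.t x) ≤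
      E.p₁ x * E.netRevenue (g.q x) (g.t x) := fun x => by
    refine mul_le_mul_of_nonneg_left ?_ (E.p₁_pos x).le
    have hbound := hu x (q x) (hq x) (hmono x) fun x' _ => by
      rw [hquantity]; exact hs.sub_add_mul_quantity_le x x'
    rw [hquantity, sellerPayoff_eq] at hbound
    change E.netRevenue (gs.q x) (gs.t x) - _ ≤ _ at hbound
    linarith
  have hrevenue : ∀ x, E.netRevenue (gs.q x) (gs.t x) = E.netRevenue (g.q x) (g.t x) := fun x =>
    mul_left_cancel₀ (E.p₁_pos x).ne' <| (sum_eq_sum_iff_of_le fun x _ => hle x).1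
      ((sum_le_sum fun x _ => hle x).antisymm (sum_mul_netRevenue_le hic hir hquantity hcol))
      x (mem_univ x)
  have hreport : ∀ x' x, E.sellerReport gs x' x = E.sellerReport g x' x := fun x' x => by
    rw [sellerReport_eq, sellerReport_eq, hrevenue, show gs.q x' = q x' from rfl, hquantity]
  refine ⟨gs, envelopeAllocation_safe hq hmono fun x x' => ?_, funext fun x => hreport x x⟩
  calc E.sellerReport gs x' x = E.sellerReport g x' x := hreport x' x
    _ ≤ E.sellerReport g x x := hs x x'
    _ = E.sellerReport gs x x := (hreport x x).symm

end Environment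

section ContinuationGames

namespace Profile

variable {n m : ℕ} {G : Mechanism} {s : Profile n m G} {E : Environment n m} {π₁ : Fin n → ℝ}
  {π₂ : Fin m → ℝ}

lemma sum_sum_mul_mul_sub (s : Profile n m G) (x : Fin n) (y : Fin m) (v : ℝ) :
    ∑ a, ∑ b, s.σ₁ x a * s.σ₂ y b * (G.t a b + v * (1 - G.q a b)) =
      ∑ a, ∑ b, s.σ₁ x a * s.σ₂ y b * G.t a b +
        v * (1 - ∑ a, ∑ b, s.σ₁ x a * s.σ₂ y b * G.q a b) := by
  have hone : ∑ a, ∑ b, s.σ₁ x a * s.σ₂ y b = 1 := by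
    rw [← sum_mul_sum, (s.σ₁_mem x).2, (s.σ₂_mem y).2, mul_one]
  calc ∑ a, ∑ b, s.σ₁ x a * s.σ₂ y b * (G.t a b + v * (1 - G.q a b))
      = ∑ a, ∑ b, s.σ₁ x a * s.σ₂ y b * G.t a b + v * (∑ a, ∑ b, s.σ₁ x a * s.σ₂ y b -
          ∑ a, ∑ b, s.σ₁ x a * s.σ₂ y b * G.q a b) := by
        simp only [← sum_sub_distrib, mul_sum, ← sum_add_distrib]
        exact sum_congr rfl fun a _ => sum_congr rfl fun b _ => by ring
    _ = _ := by rw [hone]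

lemma IsSequential.sellerReport_allocation (h : s.IsSequential E π₁ π₂) (x' x : Fin n) :
    E.sellerReport s.allocation x' x =
      ∑ y, E.p₂ y * (1 - s.γ₂ y) * (E.v₁₁ x + E.v₁₂ y) +
        (∑ y, E.p₂ y * s.γ₂ y) * ∑ a, s.σ₁ x' a * s.sellerActionPayoff E π₂ x a := by
  have hbayes := h.bayes
  set P := ∑ y, E.p₂ y * s.γ₂ y
  have haccept : P * ∑ a, s.σ₁ x' a * s.sellerActionPayoff E π₂ x a =
      ∑ y, E.p₂ y * s.γ₂ y * ∑ a, ∑ b, s.σ₁ x' a * s.σ₂ y b *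
        (G.t a b + (E.v₁₁ x + E.v₁₂ y) * (1 - G.q a b)) := by
    simp only [sellerActionPayoff, mul_sum, ← hbayes]
    rw [sum_comm]
    exact sum_congr rfl fun y _ => sum_congr rfl fun a _ => sum_congr rfl fun b _ => by ring
  rw [haccept, ← sum_add_distrib, Environment.sellerReport]
  refine sum_congr rfl fun y _ => ?_
  rw [sum_sum_mul_mul_sub, allocation]
  ring

lemma sum_mul_buyerReport_allocation (π₁ : Fin n → ℝ) (y' y : Fin m) :
    ∑ x, π₁ x * E.buyerReport s.allocation y' x y =
      s.γ₂ y' * ∑ b, s.σ₂ y' b * s.buyerActionPayoff E π₁ y b := by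
  simp only [Environment.buyerReport, allocation, buyerActionPayoff, mul_sum, ← sum_sub_distrib]
  conv_rhs => rw [sum_comm]
  refine sum_congr rfl fun x _ => ?_
  conv_lhs => rw [sum_comm]
  exact sum_congr rfl fun a _ => sum_congr rfl fun b _ => by ring

lemma IsSequential.sellerBIC (h : s.IsSequential E π₁ π₂) : E.SellerBIC s.allocation := by
  intro x x'
  rw [Environment.sellerPayoff, h.sellerReport_allocation, h.sellerReport_allocation]
  refine add_le_add le_rfl (mul_le_mul_of_nonneg_left ?_
    (sum_nonneg fun y _ => mul_nonneg (E.p₂_pos y).le (s.γ₂_mem y).1))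
  calc ∑ a, s.σ₁ x' a * s.sellerActionPayoff E π₂ x a
      ≤ ∑ a, s.σ₁ x' a * ∑ b, s.σ₁ x b * s.sellerActionPayoff E π₂ x b :=
        sum_le_sum fun a _ => mul_le_mul_of_nonneg_left (h.seller_opt x a) ((s.σ₁_mem x').1 a)
    _ = _ := sum_mul_const_of_mem_stdSimplex (s.σ₁_mem x') _

lemma IsSequential.buyerBIC (h : s.IsSequential E π₁ π₂) : E.BuyerBIC π₁ s.allocation := by
  intro y y'
  rw [sum_mul_buyerReport_allocation, sum_mul_buyerReport_allocation]
  calc s.γ₂ y' * ∑ b, s.σ₂ y' b * s.buyerActionPayoff E π₁ y b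
      ≤ s.γ₂ y' * ∑ b, s.σ₂ y' b * s.acceptPayoff E π₁ y :=
        mul_le_mul_of_nonneg_left (sum_le_sum fun b _ =>
          mul_le_mul_of_nonneg_left (h.buyer_opt y b) ((s.σ₂_mem y').1 b)) (s.γ₂_mem y').1
    _ = s.γ₂ y' * s.acceptPayoff E π₁ y := by
        rw [sum_mul_const_of_mem_stdSimplex (s.σ₂_mem y')]
    _ ≤ _ := h.accept_opt y _ (s.γ₂_mem y')

lemma IsSequential.buyerBIR (h : s.IsSequential E π₁ π₂) : E.BuyerBIR π₁ s.allocation := by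
  intro y
  rw [sum_mul_buyerReport_allocation]
  have hreject := h.accept_opt y 0 ⟨le_rfl, zero_le_one⟩
  rwa [zero_mul] at hreject

end Profile

end ContinuationGames

section Equilibria

variable {n m : ℕ} {E : Environment n m}

/-- The mechanism that never trades. -/
def noTrade : Mechanism where
  S₁ := Unit
  S₂ := Unit
  q _ _ := 0
  t _ _ := 0
  q_mem _ _ := by simp

lemma sellerPayoff_noTrade (s : Profile n m noTrade) (x : Fin n) :
    E.sellerPayoff s.allocation x = E.keepPayoff x := by
  simp [Environment.sellerPayoff, Environment.sellerReport, Environment.keepPayoff,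
    Profile.allocation, noTrade]

namespace Assessment

variable [MeasurableSpace Mechanism] {A : Assessment n m} {g : Allocation n m}

/-- `g` is the allocation that results from the assessment, averaged over the offers. -/
def Induces (A : Assessment n m) (g : Allocation n m) : Prop :=
  ∀ x y, g.q x y = ∫ G, (A.cont G).allocation.q x y ∂(A.γ₁ x) ∧
    g.t x y = ∫ G, (A.cont G).allocation.t x y ∂(A.γ₁ x)

lemma IsEquilibrium.integrable_keep (hA : A.IsEquilibrium E) (x : Fin n) (y : Fin m) :
    Integrable (fun G => 1 - (A.cont G).allocation.q x y) (A.γ₁ x) :=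
  have := A.prob x
  (integrable_const 1).sub (hA.integrable_q x y)

lemma IsEquilibrium.integrable_sellerReport (hA : A.IsEquilibrium E) (x' x : Fin n) :
    Integrable (fun G => E.sellerReport (A.cont G).allocation x' x) (A.γ₁ x') :=
  integrable_finsetSum _ fun y _ =>
    ((hA.integrable_t x' y).add ((hA.integrable_keep x' y).const_mul _)).const_mul _

lemma IsEquilibrium.integrable_buyerReport (hA : A.IsEquilibrium E) (x : Fin n) (y' y : Fin m) :
    Integrable (fun G => E.buyerReport (A.cont G).allocation y' x y) (A.γ₁ x) :=
  ((hA.integrable_q x y').const_mul _).sub (hA.integrable_t x y')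

lemma Induces.sellerReport_eq_integral (hg : A.Induces g) (hA : A.IsEquilibrium E) (x' x : Fin n) :
    E.sellerReport g x' x = ∫ G, E.sellerReport (A.cont G).allocation x' x ∂(A.γ₁ x') := by
  have := A.prob x'
  simp only [Environment.sellerReport]
  rw [integral_finsetSum]
  swap
  · exact fun y _ =>
      ((hA.integrable_t x' y).add ((hA.integrable_keep x' y).const_mul _)).const_mul _
  refine sum_congr rfl fun y _ => ?_
  rw [integral_const_mul,
    integral_add (hA.integrable_t x' y) ((hA.integrable_keep x' y).const_mul _),
    integral_const_mul, integral_sub (integrable_const 1) (hA.integrable_q x' y), integral_const,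
    probReal_univ, one_smul, ← (hg x' y).1, ← (hg x' y).2]

lemma Induces.buyerReport_eq_integral (hg : A.Induces g) (hA : A.IsEquilibrium E) (x : Fin n)
    (y' y : Fin m) :
    E.buyerReport g y' x y = ∫ G, E.buyerReport (A.cont G).allocation y' x y ∂(A.γ₁ x) := by
  simp only [Environment.buyerReport]
  rw [integral_sub ((hA.integrable_q x y').const_mul _) (hA.integrable_t x y'),
    integral_const_mul, (hg x y').1, (hg x y').2]

lemma IsEquilibrium.sellerPayoff_le (hA : A.IsEquilibrium E) (hg : A.Induces g) (G : Mechanism)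
    (x : Fin n) : E.sellerPayoff (A.cont G).allocation x ≤ E.sellerPayoff g x :=
  (hA.offer_opt x G).trans_eq (hg.sellerReport_eq_integral hA x x).symm

lemma IsEquilibrium.offerLaw_smul_integrable (hA : A.IsEquilibrium E) {f : Mechanism → ℝ}
    {x : Fin n} (hf : Integrable f (A.γ₁ x)) :
    Integrable (fun G => A.π₁ G x * f G) (A.offerLaw E) := by
  have hsmul := hf.smul_measure (ENNReal.ofReal_ne_top (r := E.p₁ x))
  rw [hA.bayes x, integrable_withDensity_iff_integrable_smul₀'
    (hA.measurable_belief x).ennreal_ofReal (ae_of_all _ fun _ => ENNReal.ofReal_lt_top)] at hsmul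
  simpa only [ENNReal.toReal_ofReal ((A.π₁_mem _).1 x), smul_eq_mul] using hsmul

lemma IsEquilibrium.mul_integral_eq (hA : A.IsEquilibrium E) (f : Mechanism → ℝ) (x : Fin n) :
    E.p₁ x * ∫ G, f G ∂(A.γ₁ x) = ∫ G, A.π₁ G x * f G ∂(A.offerLaw E) := by
  calc E.p₁ x * ∫ G, f G ∂(A.γ₁ x) = ∫ G, f G ∂(ENNReal.ofReal (E.p₁ x) • A.γ₁ x) := by
        rw [integral_smul_measure, ENNReal.toReal_ofReal (E.p₁_pos x).le, smul_eq_mul]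
    _ = ∫ G, A.π₁ G x * f G ∂(A.offerLaw E) := by
        rw [hA.bayes x, integral_withDensity_eq_integral_toReal_smul₀
          (hA.measurable_belief x).ennreal_ofReal (ae_of_all _ fun _ => ENNReal.ofReal_lt_top)]
        simp only [ENNReal.toReal_ofReal ((A.π₁_mem _).1 x), smul_eq_mul]

lemma IsEquilibrium.integrable_sum_mul_buyerReport (hA : A.IsEquilibrium E) (y' y : Fin m) :
    Integrable (fun G => ∑ x, A.π₁ G x * E.buyerReport (A.cont G).allocation y' x y)
      (A.offerLaw E) :=
  integrable_finsetSum _ fun x _ => hA.offerLaw_smul_integrable (hA.integrable_buyerReport x y' y)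

lemma Induces.sum_mul_buyerReport_eq_integral (hg : A.Induces g) (hA : A.IsEquilibrium E)
    (y' y : Fin m) :
    ∑ x, E.p₁ x * E.buyerReport g y' x y =
      ∫ G, ∑ x, A.π₁ G x * E.buyerReport (A.cont G).allocation y' x y ∂(A.offerLaw E) := by
  rw [integral_finsetSum _ fun x _ =>
    hA.offerLaw_smul_integrable (hA.integrable_buyerReport x y' y)]
  simp only [hg.buyerReport_eq_integral hA, hA.mul_integral_eq]

end Assessment

namespace Environment.IsEquilibriumAllocation

variable [MeasurableSpace Mechanism] {g : Allocation n m}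

lemma sellerBIC (hg : E.IsEquilibriumAllocation g) : E.SellerBIC g := by
  obtain ⟨A, hA, hg : A.Induces g⟩ := hg
  intro x x'
  have := A.prob x'
  calc E.sellerReport g x' x
      = ∫ G, E.sellerReport (A.cont G).allocation x' x ∂(A.γ₁ x') :=
        hg.sellerReport_eq_integral hA x' x
    _ ≤ ∫ _, E.sellerPayoff g x ∂(A.γ₁ x') :=
        integral_mono (hA.integrable_sellerReport x' x) (integrable_const _) fun G =>
          ((hA.sequential G).sellerBIC x x').trans (hA.sellerPayoff_le hg G x)
    _ = E.sellerPayoff g x := by rw [integral_const, probReal_univ, one_smul]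

lemma keepPayoff_le (hg : E.IsEquilibriumAllocation g) (x : Fin n) :
    E.keepPayoff x ≤ E.sellerPayoff g x := by
  obtain ⟨A, hA, hg⟩ := hg
  rw [← sellerPayoff_noTrade (A.cont noTrade)]
  exact hA.sellerPayoff_le hg noTrade x

lemma buyerBIC (hg : E.IsEquilibriumAllocation g) : E.BuyerBIC E.p₁ g := by
  obtain ⟨A, hA, hg : A.Induces g⟩ := hg
  intro y y'
  rw [hg.sum_mul_buyerReport_eq_integral hA, hg.sum_mul_buyerReport_eq_integral hA]
  exact integral_mono (hA.integrable_sum_mul_buyerReport y' y)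
    (hA.integrable_sum_mul_buyerReport y y) fun G => (hA.sequential G).buyerBIC y y'

lemma buyerBIR (hg : E.IsEquilibriumAllocation g) : E.BuyerBIR E.p₁ g := by
  obtain ⟨A, hA, hg : A.Induces g⟩ := hg
  intro y
  rw [hg.sum_mul_buyerReport_eq_integral hA]
  exact integral_nonneg fun G => (hA.sequential G).buyerBIR y

end Environment.IsEquilibriumAllocation

end Equilibria

section Menus

section InclusionProbability

variable {κ : Type*} [Fintype κ] [DecidableEq κ] {σ : Finset κ → ℝ}

/-- The probability that a set drawn from the distribution `σ` contains `k`. -/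
def inclusionProb (σ : Finset κ → ℝ) (k : κ) : ℝ := ∑ S with k ∈ S, σ S

lemma sum_mul_sum_eq_sum_inclusionProb_mul (σ : Finset κ → ℝ) (c : κ → ℝ) :
    ∑ S, σ S * ∑ k ∈ S, c k = ∑ k, inclusionProb σ k * c k := by
  simp only [inclusionProb, sum_mul, mul_sum]
  exact sum_comm' (by simp)

lemma inclusionProb_mem_Icc (hσ : σ ∈ stdSimplex ℝ (Finset κ)) (k : κ) :
    inclusionProb σ k ∈ Set.Icc (0 : ℝ) 1 :=
  ⟨sum_nonneg fun S _ => hσ.1 S,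
    (sum_le_sum_of_subset_of_nonneg (filter_subset _ _) fun S _ _ => hσ.1 S).trans_eq hσ.2⟩

lemma inclusionProb_eq_one (hσ : σ ∈ stdSimplex ℝ (Finset κ)) {k : κ}
    (h : ∀ S, σ S ≠ 0 → k ∈ S) : inclusionProb σ k = 1 := by
  rw [← hσ.2]
  refine sum_subset (filter_subset _ _) fun S _ hS => ?_
  by_contra hne
  exact hS (by simpa using h S hne)

lemma inclusionProb_eq_zero {k : κ} (h : ∀ S, σ S ≠ 0 → k ∉ S) : inclusionProb σ k = 0 := by
  refine sum_eq_zero fun S hS => ?_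
  by_contra hne
  exact h S hne (by simpa using hS)

end InclusionProbability

variable {n m : ℕ} {E : Environment n m} {π₁ : Fin n → ℝ} {π₂ : Fin m → ℝ}

namespace Profile

variable {G : Mechanism} {s : Profile n m G}

lemma IsSequential.γ₂_eq_one (h : s.IsSequential E π₁ π₂) {y : Fin m}
    (hpos : 0 < s.acceptPayoff E π₁ y) : s.γ₂ y = 1 :=
  (s.γ₂_mem y).2.antisymm (le_of_mul_le_mul_right (h.accept_opt y 1 ⟨zero_le_one, le_rfl⟩) hpos)

lemma IsSequential.belief_eq (h : s.IsSequential E π₁ π₂) (hγ : ∀ y, s.γ₂ y = 1) :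
    π₂ = E.p₂ :=
  funext fun y => by simpa [hγ, E.p₂_sum] using h.bayes y

lemma IsSequential.sellerPayoff_allocation (h : s.IsSequential E π₁ π₂) (hγ : ∀ y, s.γ₂ y = 1)
    (x : Fin n) :
    E.sellerPayoff s.allocation x = ∑ a, s.σ₁ x a * s.sellerActionPayoff E π₂ x a := by
  rw [Environment.sellerPayoff, h.sellerReport_allocation]
  simp [hγ, E.p₂_sum]

end Profile

namespace Environment

variable (E)

/-- The expected gain of seller type `x` over keeping the good when she sells it at the price `c` to
each buyer type `y` with probability `β y`. -/
def saleGain (x : Fin n) (c : ℝ) (β : Fin m → ℝ) : ℝ :=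
  ∑ y, E.p₂ y * (β y * (c - (E.v₁₁ x + E.v₁₂ y)))

end Environment

/-- A menu of increments. Once the seller has chosen an action `a : A`, the good is transferred with
probability `base a` for the payment `basePay a`, and the buyer may add any set of increments, the
`k`-th of which raises the probability by `share a k` at the unit price `price a k`. -/
structure Menu (A : Type) (m : ℕ) where
  base : A → ℝ
  basePay : A → ℝ
  share : A → Fin m → ℝ
  price : A → Fin m → ℝ
  base_nonneg : ∀ a, 0 ≤ base a
  share_nonneg : ∀ a k, 0 ≤ share a k
  base_add_sum_share_le_one : ∀ a, base a + ∑ k, share a k ≤ 1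

namespace Menu

variable {A : Type}

/-- The game form of a menu, in which the seller's choice and the buyer's are simultaneous. -/
def mechanism [Fintype A] [Nonempty A] (M : Menu A m) : Mechanism where
  S₁ := A
  S₂ := Finset (Fin m)
  q a S := M.base a + ∑ k ∈ S, M.share a k
  t a S := M.basePay a + ∑ k ∈ S, M.share a k * M.price a k
  q_mem a S := ⟨add_nonneg (M.base_nonneg a) (sum_nonneg fun k _ => M.share_nonneg a k),
    (add_le_add le_rfl (sum_le_sum_of_subset_of_nonneg (subset_univ S) fun k _ _ =>
      M.share_nonneg a k)).trans (M.base_add_sum_share_le_one a)⟩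

/-- The payoff of seller type `x` from the action `a` when buyer type `y` buys increment `k` with
probability `β y k`. -/
def sellerValue (M : Menu A m) (E : Environment n m) (β : Fin m → Fin m → ℝ) (x : Fin n) (a : A) :
    ℝ :=
  E.keepPayoff x + (M.basePay a - M.base a * E.keepPayoff x) +
    ∑ k, M.share a k * E.saleGain x (M.price a k) fun y => β y k

/-- The expected surplus of buyer type `y` with belief `π₁` from increment `k` when the seller
plays `α`. -/
def buyerSurplus (M : Menu A m) (E : Environment n m) (α : Fin n → A) (π₁ : Fin n → ℝ)
    (y k : Fin m) : ℝ :=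
  ∑ x, π₁ x * (M.share (α x) k * (E.v₂₁ x + E.v₂₂ y - M.price (α x) k))

/-- The menu has a determinate solution: every buyer type strictly gains from the base transaction,
and the action `α x` is strictly dominant for seller type `x`. -/
structure Implements (M : Menu A m) (E : Environment n m) (α : Fin n → A) : Prop where
  base_gain : ∀ x y a, 0 < (E.v₂₁ x + E.v₂₂ y) * M.base a - M.basePay a
  dominant : ∀ β : Fin m → Fin m → ℝ, (∀ y k, β y k ∈ Set.Icc (0 : ℝ) 1) → ∀ x a, a ≠ α x →
    M.sellerValue E β x a < M.sellerValue E β x (α x)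

/-- `β` are purchase probabilities of a buyer with belief `π₁` who best responds to `α`. -/
structure IsBuyerResponse (M : Menu A m) (E : Environment n m) (α : Fin n → A) (π₁ : Fin n → ℝ)
    (β : Fin m → Fin m → ℝ) : Prop where
  mem : ∀ y k, β y k ∈ Set.Icc (0 : ℝ) 1
  eq_one : ∀ y k, 0 < M.buyerSurplus E α π₁ y k → β y k = 1
  eq_zero : ∀ y k, M.buyerSurplus E α π₁ y k < 0 → β y k = 0

variable {M : Menu A m} {α : Fin n → A}

lemma buyerSurplus_lt_buyerSurplus (hπ : π₁ ∈ stdSimplex ℝ (Fin n)) {k y y' : Fin m}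
    (hshare : ∀ x, 0 < M.share (α x) k) (hy : y < y') :
    M.buyerSurplus E α π₁ y k < M.buyerSurplus E α π₁ y' k := by
  have hgain : 0 < ∑ x, π₁ x * (M.share (α x) k * (E.v₂₂ y' - E.v₂₂ y)) :=
    sum_mul_pos_of_mem_stdSimplex hπ fun x _ =>
      mul_pos (hshare x) (sub_pos.2 (E.v₂₂_strictMono hy))
  rw [← sub_pos, buyerSurplus, buyerSurplus, ← sum_sub_distrib]
  exact hgain.trans_eq (sum_congr rfl fun x _ => by ring)

lemma IsBuyerResponse.monotone {β : Fin m → Fin m → ℝ} (h : M.IsBuyerResponse E α π₁ β)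
    (hπ : π₁ ∈ stdSimplex ℝ (Fin n)) {k : Fin m} (hshare : ∀ x, 0 < M.share (α x) k) :
    Monotone fun y => β y k := by
  refine monotone_iff_forall_lt.2 fun y y' hy => ?_
  rcases lt_or_ge (M.buyerSurplus E α π₁ y k) 0 with hneg | hnonneg
  · exact (h.eq_zero y k hneg).trans_le (h.mem y' k).1
  · exact (h.mem y k).2.trans_eq
      (h.eq_one y' k (hnonneg.trans_lt (buyerSurplus_lt_buyerSurplus hπ hshare hy))).symm

lemma sum_mul_outcome (M : Menu A m) {σ : Finset (Fin m) → ℝ}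
    (hσ : σ ∈ stdSimplex ℝ (Finset (Fin m))) (a : A) (v : ℝ) :
    ∑ S, σ S * ((M.basePay a + ∑ k ∈ S, M.share a k * M.price a k) +
        v * (1 - (M.base a + ∑ k ∈ S, M.share a k))) =
      M.basePay a + v * (1 - M.base a) +
        ∑ k, inclusionProb σ k * (M.share a k * (M.price a k - v)) := by
  rw [← sum_mul_sum_eq_sum_inclusionProb_mul, ← sum_mul_const_of_mem_stdSimplex hσ
    (M.basePay a + _), ← sum_add_distrib]
  refine sum_congr rfl fun S _ => ?_
  simp only [mul_sub, sum_sub_distrib, ← sum_mul]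
  ring

variable [Fintype A] [Nonempty A]

lemma sellerActionPayoff_mechanism (s : Profile n m M.mechanism) (x : Fin n) (a : A) :
    s.sellerActionPayoff E E.p₂ x a =
      M.sellerValue E (fun y k => inclusionProb (s.σ₂ y) k) x a := by
  have hinner : ∀ y, ∑ S, s.σ₂ y S * (M.mechanism.t a S +
        (E.v₁₁ x + E.v₁₂ y) * (1 - M.mechanism.q a S)) =
      M.basePay a + (E.v₁₁ x + E.v₁₂ y) * (1 - M.base a) + ∑ k, inclusionProb (s.σ₂ y) k *
        (M.share a k * (M.price a k - (E.v₁₁ x + E.v₁₂ y))) :=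
    fun y => M.sum_mul_outcome (s.σ₂_mem y) a _
  have hbase : E.keepPayoff x + (M.basePay a - M.base a * E.keepPayoff x) =
      ∑ y, E.p₂ y * (M.basePay a + (E.v₁₁ x + E.v₁₂ y) * (1 - M.base a)) := by
    simp only [mul_add, sum_add_distrib, ← sum_mul, E.p₂_sum, ← mul_assoc, Environment.keepPayoff]
    ring
  simp only [Profile.sellerActionPayoff, hinner, sellerValue, Environment.saleGain, hbase,
    mul_add _ (_ + _), sum_add_distrib, mul_sum]
  rw [sum_comm]
  congr 1
  exact sum_congr rfl fun k _ => sum_congr rfl fun y _ => by ring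

lemma buyerActionPayoff_empty_pos (hM : M.Implements E α) (s : Profile n m M.mechanism)
    (hπ : π₁ ∈ stdSimplex ℝ (Fin n)) (y : Fin m) :
    0 < s.buyerActionPayoff E π₁ y (∅ : Finset (Fin m)) :=
  sum_mul_pos_of_mem_stdSimplex hπ fun x _ =>
    sum_mul_pos_of_mem_stdSimplex (s.σ₁_mem x) fun a _ => by
      simpa [mechanism] using hM.base_gain x y a

lemma buyerActionPayoff_mechanism [DecidableEq A] {s : Profile n m M.mechanism}
    (hσ : ∀ x, s.σ₁ x = (Pi.single (α x) 1 : A → ℝ)) (y : Fin m) (S : Finset (Fin m)) :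
    s.buyerActionPayoff E π₁ y S =
      ∑ x, π₁ x * ((E.v₂₁ x + E.v₂₂ y) * M.base (α x) - M.basePay (α x)) +
        ∑ k ∈ S, M.buyerSurplus E α π₁ y k := by
  have hinner : ∀ x, ∑ a : A, s.σ₁ x a * ((E.v₂₁ x + E.v₂₂ y) * M.mechanism.q a S -
        M.mechanism.t a S) =
      (E.v₂₁ x + E.v₂₂ y) * M.base (α x) - M.basePay (α x) +
        ∑ k ∈ S, M.share (α x) k * (E.v₂₁ x + E.v₂₂ y - M.price (α x) k) := fun x => by
    rw [hσ, sum_single_one_mul]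
    simp only [mechanism, mul_sub, sum_sub_distrib, ← sum_mul]
    ring
  simp only [buyerSurplus]
  rw [sum_comm, ← sum_add_distrib]
  refine sum_congr rfl fun x _ => ?_
  rw [← mul_sum, ← mul_add, ← hinner]
  rfl

lemma Implements.strategy_eq [DecidableEq A] (hM : M.Implements E α)
    {s : Profile n m M.mechanism} (hs : s.IsSequential E π₁ E.p₂) (x : Fin n) :
    s.σ₁ x = (Pi.single (α x) 1 : A → ℝ) := by
  refine eq_single_of_mem_stdSimplex (ι := A) (s.σ₁_mem x) fun a ha => ?_
  by_contra hne
  have hopt := hs.seller_opt x (α x)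
  rw [← eq_sum_mul_of_forall_le (s.σ₁_mem x) (hs.seller_opt x) hne, sellerActionPayoff_mechanism,
    sellerActionPayoff_mechanism] at hopt
  exact hopt.not_gt
    (hM.dominant _ (fun y => inclusionProb_mem_Icc (s.σ₂_mem y)) x a ha)

lemma isBuyerResponse_inclusionProb [DecidableEq A] {s : Profile n m M.mechanism}
    (hs : s.IsSequential E π₁ π₂) (hσ : ∀ x, s.σ₁ x = (Pi.single (α x) 1 : A → ℝ)) :
    M.IsBuyerResponse E α π₁ fun y k => inclusionProb (s.σ₂ y) k := by
  have hopt : ∀ y (S S' : Finset (Fin m)), s.σ₂ y S ≠ 0 →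
      ∑ k ∈ S', M.buyerSurplus E α π₁ y k ≤ ∑ k ∈ S, M.buyerSurplus E α π₁ y k := by
    intro y S S' hS
    have hle := hs.buyer_opt y S'
    rwa [Profile.acceptPayoff, ← eq_sum_mul_of_forall_le (s.σ₂_mem y) (hs.buyer_opt y) hS,
      buyerActionPayoff_mechanism hσ, buyerActionPayoff_mechanism hσ, add_le_add_iff_left] at hle
  refine ⟨fun y => inclusionProb_mem_Icc (s.σ₂_mem y), fun y k hk => ?_, fun y k hk => ?_⟩
  · refine inclusionProb_eq_one (s.σ₂_mem y) fun S hS => ?_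
    by_contra hkS
    have hle := hopt y S (insert k S) hS
    rw [sum_insert hkS] at hle
    linarith
  · refine inclusionProb_eq_zero fun S hS hkS => ?_
    have hle := hopt y S (S.erase k) hS
    rw [← add_sum_erase S _ hkS] at hle
    linarith

lemma Implements.exists_isBuyerResponse (hM : M.Implements E α)
    (hπ : π₁ ∈ stdSimplex ℝ (Fin n)) {g : Allocation n m} (hg : g ∈ E.BR π₁ M.mechanism) :
    ∃ β, M.IsBuyerResponse E α π₁ β ∧ ∀ x, E.sellerPayoff g x = M.sellerValue E β x (α x) := by
  classical
  obtain ⟨s, π₂, hs, rfl⟩ := hg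
  have hγ : ∀ y, s.γ₂ y = 1 := fun y => hs.γ₂_eq_one
    ((buyerActionPayoff_empty_pos hM s hπ y).trans_le (hs.buyer_opt y _))
  obtain rfl := hs.belief_eq hγ
  have hσ := hM.strategy_eq hs
  refine ⟨_, isBuyerResponse_inclusionProb hs hσ, fun x => ?_⟩
  rw [hs.sellerPayoff_allocation hγ, ← sellerActionPayoff_mechanism, hσ]
  exact sum_single_one_mul (α x) _

/-- The profile in which the buyer accepts and buys the increments that yield a positive surplus. -/
noncomputable def responseProfile [DecidableEq A] (M : Menu A m) (E : Environment n m)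
    (α : Fin n → A) (π₁ : Fin n → ℝ) : Profile n m M.mechanism where
  γ₂ _ := 1
  σ₁ x := (Pi.single (α x) 1 : A → ℝ)
  σ₂ y := (Pi.single ({k | 0 < M.buyerSurplus E α π₁ y k} : Finset (Fin m)) 1 :
    Finset (Fin m) → ℝ)
  γ₂_mem _ := ⟨zero_le_one, le_rfl⟩
  σ₁_mem x := single_mem_stdSimplex ℝ (α x)
  σ₂_mem _ := single_mem_stdSimplex (ι := Finset (Fin m)) ℝ _

lemma Implements.isSequential_responseProfile [DecidableEq A] (hM : M.Implements E α)
    (hπ : π₁ ∈ stdSimplex ℝ (Fin n)) :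
    (M.responseProfile E α π₁).IsSequential E π₁ E.p₂ := by
  set s := M.responseProfile E α π₁
  have hbuyer : ∀ y (S : Finset (Fin m)),
      s.buyerActionPayoff E π₁ y S ≤ s.acceptPayoff E π₁ y := fun y S => by
    have haccept : s.acceptPayoff E π₁ y =
        s.buyerActionPayoff E π₁ y ({k | 0 < M.buyerSurplus E α π₁ y k} : Finset (Fin m)) :=
      sum_single_one_mul (ι := Finset (Fin m)) _ _
    rw [haccept, buyerActionPayoff_mechanism (fun _ => rfl),
      buyerActionPayoff_mechanism (fun _ => rfl), add_le_add_iff_left, sum_filter]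
    calc ∑ k ∈ S, M.buyerSurplus E α π₁ y k
        ≤ ∑ k ∈ S, if 0 < M.buyerSurplus E α π₁ y k then M.buyerSurplus E α π₁ y k else 0 :=
          sum_le_sum fun k _ => by split_ifs <;> linarith
      _ ≤ _ := sum_le_sum_of_subset_of_nonneg (subset_univ S) fun k _ _ => by
          split_ifs <;> linarith
  refine ⟨⟨fun y => (E.p₂_pos y).le, E.p₂_sum⟩, fun y => ?_, fun x (a : A) => ?_, hbuyer,
    fun y c hc => ?_⟩
  · simp [s, responseProfile, E.p₂_sum]
  · have hvalue : ∑ b, s.σ₁ x b * s.sellerActionPayoff E E.p₂ x b =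
        s.sellerActionPayoff E E.p₂ x (α x) := sum_single_one_mul (α x) _
    rw [hvalue, sellerActionPayoff_mechanism, sellerActionPayoff_mechanism]
    rcases eq_or_ne a (α x) with rfl | ha
    · rfl
    · exact (hM.dominant _ (fun y => inclusionProb_mem_Icc (s.σ₂_mem y)) x a ha).le
  · have hpos := (buyerActionPayoff_empty_pos hM s hπ y).trans_le (hbuyer y ∅)
    exact mul_le_mul_of_nonneg_right hc.2 hpos.le

lemma Implements.BR_nonempty (hM : M.Implements E α) (hπ : π₁ ∈ stdSimplex ℝ (Fin n)) :
    (E.BR π₁ M.mechanism).Nonempty := by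
  classical
  exact ⟨_, _, _, hM.isSequential_responseProfile hπ, rfl⟩

end Menu

end Menus

section PostedPrices

namespace Environment

variable {n m : ℕ} (E : Environment n m)

/-- The probability of the buyer types that buy at a price to which type `k` is indifferent. -/
def tail (k : Fin m) : ℝ := ∑ y ∈ Ici k, E.p₂ y

/-- The expected gain of seller type `x` from posting the price to which buyer type `k` is
indifferent when the buyer believes to face the seller type `xs`. -/
def margin (xs x : Fin n) (k : Fin m) : ℝ :=
  ∑ y ∈ Ici k, E.p₂ y * (E.v₂₁ xs + E.v₂₂ k - (E.v₁₁ x + E.v₁₂ y))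

lemma tail_pos (k : Fin m) : 0 < E.tail k :=
  sum_pos (fun y _ => E.p₂_pos y) ⟨k, mem_Ici.2 le_rfl⟩

lemma margin_eq_add_mul_tail (xs x : Fin n) (k : Fin m) :
    E.margin xs x k = E.margin xs xs k + (E.v₁₁ xs - E.v₁₁ x) * E.tail k := by
  simp only [margin, tail, mul_sum, ← sum_add_distrib]
  exact sum_congr rfl fun y _ => by ring

lemma sum_mul_margin (w : Fin m → ℝ) (xs x : Fin n) :
    ∑ k, w k * E.margin xs x k =
      ∑ k, w k * E.margin xs xs k + (E.v₁₁ xs - E.v₁₁ x) * ∑ k, w k * E.tail k := by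
  rw [mul_sum, ← sum_add_distrib]
  exact sum_congr rfl fun k _ => by rw [E.margin_eq_add_mul_tail xs x k]; ring

lemma sum_increment_mul_tail (q : Fin m → ℝ) :
    ∑ k, increment q k * E.tail k = E.quantity q := by
  simp only [tail, ← sum_mul_sum_Iic, sum_Iic_increment, quantity]

lemma sum_increment_mul_margin (q : Fin m → ℝ) (xs x : Fin n) :
    ∑ k, increment q k * E.margin xs x k =
      E.netRevenue q (envelopePayment (fun k => E.v₂₁ xs + E.v₂₂ k) q) -
        E.v₁₁ x * E.quantity q := by
  have hsplit : ∀ k, increment q k * E.margin xs x k =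
      (E.v₂₁ xs + E.v₂₂ k) * increment q k * ∑ y ∈ Ici k, E.p₂ y -
        increment q k * ∑ y ∈ Ici k, E.p₂ y * (E.v₁₁ x + E.v₁₂ y) := fun k => by
    simp only [margin, mul_sum, ← sum_sub_distrib]
    exact sum_congr rfl fun y _ => by ring
  simp only [hsplit, sum_sub_distrib, ← sum_mul_sum_Iic, sum_Iic_increment, netRevenue, quantity,
    mul_sum (s := (univ : Finset (Fin m)))]
  rw [← sum_sub_distrib, ← sum_sub_distrib]
  exact sum_congr rfl fun y _ => by rw [envelopePayment]; ring

variable {E}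

lemma quantity_mem_Icc {β : Fin m → ℝ} (hβ : ∀ y, β y ∈ Set.Icc (0 : ℝ) 1) :
    E.quantity β ∈ Set.Icc (0 : ℝ) 1 :=
  ⟨sum_nonneg fun y _ => mul_nonneg (E.p₂_pos y).le (hβ y).1,
    (sum_le_sum fun y _ => mul_le_of_le_one_right (E.p₂_pos y).le (hβ y).2).trans_eq E.p₂_sum⟩

lemma saleGain_sub_saleGain (x : Fin n) (c c' : ℝ) (β : Fin m → ℝ) :
    E.saleGain x c β - E.saleGain x c' β = (c - c') * E.quantity β := by
  rw [saleGain, saleGain, quantity, mul_sum, ← sum_sub_distrib]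
  exact sum_congr rfl fun y _ => by ring

-- Type `xs` gains from the sale to buyer type `k` at least, on whom her valuation is the largest
-- among the buyer types below `k`.
lemma valuation_le_of_margin_nonneg {xs : Fin n} {k y : Fin m} (hm : 0 ≤ E.margin xs xs k)
    (hy : y ≤ k) : E.v₁₁ xs + E.v₁₂ y ≤ E.v₂₁ xs + E.v₂₂ k := by
  by_contra! hlt
  refine hm.not_gt (sum_neg (fun z hz => mul_neg_of_pos_of_neg (E.p₂_pos z) ?_)
    ⟨k, mem_Ici.2 le_rfl⟩)
  linarith [E.v₁₂_mono (hy.trans (mem_Ici.1 hz))]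

lemma saleGain_le_margin {xs x : Fin n} {k : Fin m} {β : Fin m → ℝ} (hm : 0 ≤ E.margin xs x k)
    (hβ : ∀ y, β y ∈ Set.Icc (0 : ℝ) 1) (hmono : Monotone β) (hzero : ∀ y < k, β y = 0) :
    E.saleGain x (E.v₂₁ xs + E.v₂₂ k) β ≤ E.margin xs x k := by
  have hcheb := sum_mul_mul_nonneg_of_antitoneOn (s := Ici k) (h := fun y => 1 - β y)
    (fun y _ => (E.p₂_pos y).le)
    (fun y _ y' _ hy => sub_le_sub_left (add_le_add_right (E.v₁₂_mono hy) (E.v₁₁ x)) _)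
    (fun y _ y' _ hy => sub_le_sub_left (hmono hy) 1) (fun y _ => sub_nonneg.2 (hβ y).2) hm
  have hrestrict : E.saleGain x (E.v₂₁ xs + E.v₂₂ k) β =
      ∑ y ∈ Ici k, E.p₂ y * (β y * (E.v₂₁ xs + E.v₂₂ k - (E.v₁₁ x + E.v₁₂ y))) := by
    refine (sum_subset (subset_univ _) fun y _ hy => ?_).symm
    rw [hzero y (not_le.1 fun hle => hy (mem_Ici.2 hle)), zero_mul, mul_zero]
  rw [hrestrict, ← sub_nonneg, margin, ← sum_sub_distrib]
  exact hcheb.trans_eq (sum_congr rfl fun y _ => by ring)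

lemma margin_le_saleGain {xs : Fin n} {k : Fin m} {β : Fin m → ℝ} (hm : 0 ≤ E.margin xs xs k)
    (hβ : ∀ y, 0 ≤ β y) (hone : ∀ y, k ≤ y → β y = 1) :
    E.margin xs xs k ≤ E.saleGain xs (E.v₂₁ xs + E.v₂₂ k) β := by
  calc E.margin xs xs k = ∑ y ∈ Ici k,
        E.p₂ y * (β y * (E.v₂₁ xs + E.v₂₂ k - (E.v₁₁ xs + E.v₁₂ y))) :=
        sum_congr rfl fun y hy => by rw [hone y (mem_Ici.1 hy), one_mul]
    _ ≤ _ := sum_le_sum_of_subset_of_nonneg (subset_univ _) fun y _ hy =>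
        mul_nonneg (E.p₂_pos y).le <| mul_nonneg (hβ y) <| sub_nonneg.2 <|
          valuation_le_of_margin_nonneg hm (not_le.1 fun hle => hy (mem_Ici.2 hle)).le

end Environment

end PostedPrices

section Upsetting

variable {n m : ℕ} {E : Environment n m}

/-- A mechanism that upsets the payoffs `u` by the intuitive criterion: the types below `xs` lose
whatever the buyer believes, and `xs` gains whenever the buyer's belief excludes them. -/
structure Upsets (E : Environment n m) (u : Fin n → ℝ) (xs : Fin n) (G : Mechanism) : Prop where
  lower_lose : ∀ π₁ ∈ stdSimplex ℝ (Fin n), ∀ g ∈ E.BR π₁ G, ∀ x < xs, E.sellerPayoff g x < u x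
  gain : ∀ π₁ ∈ stdSimplex ℝ (Fin n), (∀ x < xs, π₁ x = 0) → ∀ g ∈ E.BR π₁ G,
    u xs < E.sellerPayoff g xs
  nonempty : ∀ π₁ ∈ stdSimplex ℝ (Fin n), (E.BR π₁ G).Nonempty

lemma Upsets.not_passesIntuitive {g : Allocation n m} {xs : Fin n} {G : Mechanism}
    (h : Upsets E (E.sellerPayoff g) xs G) : ¬ E.PassesIntuitive g := by
  classical
  refine not_not_intro ⟨G, xs, fun hempty => ?_, fun π₁ hπ hexcl g' hg' =>
    h.gain π₁ hπ (fun x hx => hexcl x (Set.eq_empty_of_forall_notMem ?_)) g' hg'⟩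
  · have hπ := single_mem_stdSimplex ℝ xs
    obtain ⟨g', hg'⟩ := h.nonempty _ hπ
    have hgain := h.gain _ hπ (fun x hx => Pi.single_eq_of_ne hx.ne _) g' hg'
    exact (Set.union_empty_iff.1 hempty).1.subset
      ⟨Set.mem_biUnion (t := fun π₁ => E.BR π₁ G) hπ hg', hgain⟩
  · rintro g'' (⟨hB, hlt⟩ | ⟨hB, heq⟩) <;> obtain ⟨π, hπ', hB⟩ := Set.mem_iUnion₂.1 hB
    · exact hlt.not_gt (h.lower_lose π hπ' _ hB x hx)
    · exact (h.lower_lose π hπ' _ hB x hx).ne heq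

end Upsetting

section Separation

variable {n m : ℕ} {E : Environment n m} {xs : Fin n}

namespace Environment

/-- `w` is a strict subprobability on the posted prices whose posting does not hurt the seller type
`xs` when the buyer believes to face her. -/
structure IsPriceMixture (E : Environment n m) (xs : Fin n) (w : Fin m → ℝ) : Prop where
  nonneg : ∀ k, 0 ≤ w k
  sum_lt_one : ∑ k, w k < 1
  margin_nonneg : ∀ k, 0 < w k → 0 ≤ E.margin xs xs k

/-- A rule by which a menu sorts the seller types. Type `x` reports `report x`, and the report `a`
puts the fraction `share k a` of increment `k` on sale at the price at which buyer type `k` is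
indifferent if he believes the report. The field `keepPayoff_sub_sq_lt` allows a quadratic scoring
rule to make reports strictly optimal. -/
structure Separation (E : Environment n m) (xs : Fin n) where
  report : Fin n → Fin n
  share : Fin m → Fin n → ℝ
  report_of_le : ∀ x ≤ xs, report x = xs
  report_le : ∀ x, xs ≤ x → report x ≤ x
  le_report : ∀ x' < xs, ∀ x, x ≤ report x
  share_mem : ∀ k a, share k a ∈ Set.Icc (0 : ℝ) 1
  share_self : ∀ k, share k xs = 1
  share_mul_saleGain_le : ∀ k, 0 ≤ E.margin xs xs k → ∀ β : Fin m → ℝ,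
    (∀ y, β y ∈ Set.Icc (0 : ℝ) 1) → ∀ x x',
    share k (report x') * E.saleGain x (E.v₂₁ (report x') + E.v₂₂ k) β ≤
      share k (report x) * E.saleGain x (E.v₂₁ (report x) + E.v₂₂ k) β
  keepPayoff_sub_sq_lt : ∀ x x', report x' ≠ report x →
    (E.keepPayoff (report x) - E.keepPayoff x) ^ 2 <
      (E.keepPayoff (report x') - E.keepPayoff x) ^ 2

variable (E) in
/-- The payoff of seller type `x` from the scoring rule of size `ε` and bound `L` at the report
`xs`, when increment `k` is sold at full price to the buyer types above `k`. -/
def scoringPayoff (xs : Fin n) (w : Fin m → ℝ) (L ε : ℝ) (x : Fin n) : ℝ :=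
  E.keepPayoff x - 2 * ε * (L - E.keepPayoff xs) * E.keepPayoff x -
    ε * (1 + E.keepPayoff xs ^ 2) + (1 + ε ^ 2) * ∑ k, w k * E.margin xs x k

namespace Separation

variable (D : E.Separation xs) {w : Fin m → ℝ} {L ε : ℝ}

/-- Bounds on the size `ε` of the scoring rule. The scoring rule perturbs payoffs to the first order
in `ε`, and shares and prices are perturbed to the second order. -/
structure IsSmall (w : Fin m → ℝ) (L ε : ℝ) : Prop where
  pos : 0 < ε
  keepPayoff_le : ∀ a, E.keepPayoff a ≤ L
  size : ∀ a, 2 * ε * (L - E.keepPayoff a) + (1 + ε ^ 2) * ∑ k, w k ≤ 1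
  gap : ∀ y k, y < k → ε ^ 2 < E.v₂₂ k - E.v₂₂ y
  score : ∀ x x', D.report x' ≠ D.report x →
    ε ^ 2 * (1 + |E.v₂₁ (D.report x') - E.v₂₁ (D.report x)|) <
      ε * ((E.keepPayoff (D.report x') - E.keepPayoff x) ^ 2 -
        (E.keepPayoff (D.report x) - E.keepPayoff x) ^ 2)

/-- The type `x`'s own report, as an action of the menu. -/
def action (x : Fin n) : Set.range D.report := Set.rangeFactorization D.report x

instance : Nonempty (Set.range D.report) := ⟨D.action xs⟩

variable {D}

/-- The menu in which the seller's report `a` is scored by the base transaction. The share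
`ε ^ 2` keeps every increment on sale, so that purchases are determined even if `D.share` is `0`,
and the discount `ε ^ 2` makes them strict. -/
def menu (hw : E.IsPriceMixture xs w) (h : D.IsSmall w L ε) : Menu (Set.range D.report) m where
  base a := 2 * ε * (L - E.keepPayoff a)
  basePay a := -(ε * (1 + E.keepPayoff a ^ 2))
  share a k := w k * (D.share k a + ε ^ 2)
  price a k := E.v₂₁ a + E.v₂₂ k - ε ^ 2
  base_nonneg a := mul_nonneg (mul_pos two_pos h.pos).le (sub_nonneg.2 (h.keepPayoff_le a))
  share_nonneg a k := mul_nonneg (hw.nonneg k) (add_nonneg (D.share_mem k a).1 (sq_nonneg ε))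
  base_add_sum_share_le_one a := by
    refine le_trans (add_le_add le_rfl ?_) (h.size a)
    rw [mul_comm, sum_mul]
    exact sum_le_sum fun k _ =>
      mul_le_mul_of_nonneg_left (add_le_add_left (D.share_mem k a).2 _) (hw.nonneg k)

variable {hw : E.IsPriceMixture xs w} {h : D.IsSmall w L ε} {π₁ : Fin n → ℝ}
  {β : Fin m → Fin m → ℝ}

lemma menu_share_pos {k : Fin m} (hk : 0 < w k) (a : Set.range D.report) :
    0 < (menu hw h).share a k :=
  mul_pos hk (add_pos_of_nonneg_of_pos (D.share_mem k a).1 (pow_pos h.pos 2))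

lemma share_add_mul_saleGain_le {k : Fin m} (hm : 0 ≤ E.margin xs xs k) {β : Fin m → ℝ}
    (hβ : ∀ y, β y ∈ Set.Icc (0 : ℝ) 1) (ε : ℝ) (x x' : Fin n) :
    (D.share k (D.report x') + ε ^ 2) *
        E.saleGain x (E.v₂₁ (D.report x') + E.v₂₂ k - ε ^ 2) β ≤
      (D.share k (D.report x) + ε ^ 2) *
          E.saleGain x (E.v₂₁ (D.report x) + E.v₂₂ k - ε ^ 2) β +
        ε ^ 2 * (1 + |E.v₂₁ (D.report x') - E.v₂₁ (D.report x)|) := by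
  set a := D.report x'
  set b := D.report x
  have hreport := D.share_mul_saleGain_le k hm β hβ x x'
  have hdiscount : ∀ c, E.saleGain x (c - ε ^ 2) β =
      E.saleGain x c β - ε ^ 2 * E.quantity β := fun c => by
    linarith [E.saleGain_sub_saleGain x (c - ε ^ 2) c β]
  have hprice := E.saleGain_sub_saleGain x (E.v₂₁ a + E.v₂₂ k) (E.v₂₁ b + E.v₂₂ k) β
  have hquantity := E.quantity_mem_Icc hβ
  have hbound : E.quantity β * (D.share k b - D.share k a + (E.v₂₁ a - E.v₂₁ b)) ≤
      1 + |E.v₂₁ a - E.v₂₁ b| := by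
    refine (le_abs_self _).trans ?_
    rw [abs_mul, abs_of_nonneg hquantity.1]
    refine (mul_le_of_le_one_left (abs_nonneg _) hquantity.2).trans
      ((abs_add_le _ _).trans (add_le_add_left (abs_le.2 ⟨?_, ?_⟩) _)) <;>
    linarith [(D.share_mem k a).1, (D.share_mem k a).2, (D.share_mem k b).1, (D.share_mem k b).2]
  rw [hdiscount, hdiscount]
  linear_combination hreport + ε ^ 2 * hprice + ε ^ 2 * hbound

lemma sum_share_mul_saleGain_le (hβ : ∀ y k, β y k ∈ Set.Icc (0 : ℝ) 1) (x x' : Fin n) :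
    ∑ k, (menu hw h).share (D.action x') k *
        E.saleGain x ((menu hw h).price (D.action x') k) (fun y => β y k) ≤
      ∑ k, (menu hw h).share (D.action x) k *
          E.saleGain x ((menu hw h).price (D.action x) k) (fun y => β y k) +
        ε ^ 2 * (1 + |E.v₂₁ (D.report x') - E.v₂₁ (D.report x)|) := by
  set c := ε ^ 2 * (1 + |E.v₂₁ (D.report x') - E.v₂₁ (D.report x)|)
  have hc : 0 ≤ c := mul_nonneg (sq_nonneg ε) (by positivity)
  calc _ ≤ ∑ k, ((menu hw h).share (D.action x) k *
          E.saleGain x ((menu hw h).price (D.action x) k) (fun y => β y k) + w k * c) := by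
        refine sum_le_sum fun k _ => ?_
        simp only [menu, mul_assoc, ← mul_add]
        rcases (hw.nonneg k).eq_or_lt with hk | hk
        · simp [← hk]
        · exact mul_le_mul_of_nonneg_left
            (share_add_mul_saleGain_le (hw.margin_nonneg k hk) (fun y => hβ y k) ε x x') hk.le
    _ ≤ _ := by
        rw [sum_add_distrib, ← sum_mul]
        exact add_le_add le_rfl (mul_le_of_le_one_left hc hw.sum_lt_one.le)

variable (hw h) in
lemma menu_implements : (menu hw h).Implements E D.action where
  base_gain x y a := by
    have hvalue := mul_nonneg (E.v₂_nonneg x y) ((menu hw h).base_nonneg a)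
    have hpay : 0 < ε * (1 + E.keepPayoff a ^ 2) := mul_pos h.pos (by positivity)
    change 0 < _ - -_
    linarith
  dominant β hβ x := by
    rintro ⟨-, x', rfl⟩ hne
    have hscore := h.score x x' fun heq => hne (Subtype.ext heq)
    have hsale := sum_share_mul_saleGain_le (hw := hw) (h := h) hβ x x'
    have hbase : ∀ a, (menu hw h).basePay a - (menu hw h).base a * E.keepPayoff x =
        -ε - 2 * ε * L * E.keepPayoff x + ε * E.keepPayoff x ^ 2 -
          ε * (E.keepPayoff a - E.keepPayoff x) ^ 2 := fun a => by simp only [menu]; ring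
    change (menu hw h).sellerValue E β x (D.action x') < _
    rw [Menu.sellerValue, Menu.sellerValue, hbase, hbase]
    change _ + (_ - ε * (E.keepPayoff (D.report x') - _) ^ 2) + _ <
      _ + (_ - ε * (E.keepPayoff (D.report x) - _) ^ 2) + _
    linarith

lemma sellerValue_menu {x : Fin n} (hx : x ≤ xs) :
    (menu hw h).sellerValue E β x (D.action x) =
      E.keepPayoff x - 2 * ε * (L - E.keepPayoff xs) * E.keepPayoff x -
        ε * (1 + E.keepPayoff xs ^ 2) +
        (1 + ε ^ 2) * ∑ k, w k *
          (E.saleGain x (E.v₂₁ xs + E.v₂₂ k) (fun y => β y k) -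
            ε ^ 2 * E.quantity fun y => β y k) := by
  have hreport : ((D.action x : Set.range D.report) : Fin n) = xs := D.report_of_le x hx
  have hdiscount : ∀ k, E.saleGain x (E.v₂₁ xs + E.v₂₂ k - ε ^ 2) (fun y => β y k) =
      E.saleGain x (E.v₂₁ xs + E.v₂₂ k) (fun y => β y k) -
        ε ^ 2 * E.quantity fun y => β y k := fun k => by
    linarith [E.saleGain_sub_saleGain x (E.v₂₁ xs + E.v₂₂ k - ε ^ 2) (E.v₂₁ xs + E.v₂₂ k)
      fun y => β y k]
  simp only [Menu.sellerValue, menu, hreport, D.share_self, hdiscount, mul_sum]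
  congr 1
  · ring
  · exact sum_congr rfl fun k _ => by ring

lemma buyerSurplus_neg (hπ : π₁ ∈ stdSimplex ℝ (Fin n)) (hle : ∀ x, x ≤ D.report x)
    {y k : Fin m} (hk : 0 < w k) (hy : y < k) :
    (menu hw h).buyerSurplus E D.action π₁ y k < 0 := by
  have hloss : 0 < ∑ x, π₁ x * ((menu hw h).share (D.action x) k *
      (E.v₂₁ (D.report x) + E.v₂₂ k - ε ^ 2 - (E.v₂₁ x + E.v₂₂ y))) :=
    sum_mul_pos_of_mem_stdSimplex hπ fun x _ => mul_pos (menu_share_pos hk _) <| by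
      linarith [h.gap y k hy, E.v₂₁_mono (hle x)]
  rw [← neg_pos, Menu.buyerSurplus, ← sum_neg_distrib]
  refine hloss.trans_eq (sum_congr rfl fun x _ => ?_)
  change _ = -(π₁ x * (_ * (_ - (E.v₂₁ (D.report x) + E.v₂₂ k - ε ^ 2))))
  ring

lemma buyerSurplus_pos (hπ : π₁ ∈ stdSimplex ℝ (Fin n)) (hexcl : ∀ x < xs, π₁ x = 0)
    {y k : Fin m} (hk : 0 < w k) (hy : k ≤ y) :
    0 < (menu hw h).buyerSurplus E D.action π₁ y k :=
  sum_mul_pos_of_mem_stdSimplex hπ fun x hx => mul_pos (menu_share_pos hk _) <| by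
    have hreport := E.v₂₁_mono (D.report_le x (not_lt.1 fun hlt => hx (hexcl x hlt)))
    change 0 < _ - (E.v₂₁ (D.report x) + E.v₂₂ k - ε ^ 2)
    linarith [E.v₂₂_strictMono.monotone hy, pow_pos h.pos 2]

lemma sellerValue_le_scoringPayoff (hπ : π₁ ∈ stdSimplex ℝ (Fin n))
    (hβ : (menu hw h).IsBuyerResponse E D.action π₁ β) {x : Fin n} (hx : x < xs) :
    (menu hw h).sellerValue E β x (D.action x) ≤ E.scoringPayoff xs w L ε x := by
  rw [sellerValue_menu hx.le, scoringPayoff]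
  refine add_le_add le_rfl (mul_le_mul_of_nonneg_left (sum_le_sum fun k _ => ?_) (by positivity))
  rcases (hw.nonneg k).eq_or_lt with hk | hk
  · simp [← hk]
  have hmargin : 0 ≤ E.margin xs x k := by
    rw [margin_eq_add_mul_tail]
    exact add_nonneg (hw.margin_nonneg k hk)
      (mul_nonneg (sub_nonneg.2 (E.v₁₁_strictMono hx).le) (E.tail_pos k).le)
  have hsale := saleGain_le_margin hmargin (fun y => hβ.mem y k)
    (hβ.monotone hπ fun x => menu_share_pos hk _)
    fun y hy => hβ.eq_zero y k (buyerSurplus_neg hπ (D.le_report x hx) hk hy)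
  have hquantity := (E.quantity_mem_Icc fun y => hβ.mem y k).1
  exact mul_le_mul_of_nonneg_left (by linarith [mul_nonneg (sq_nonneg ε) hquantity]) hk.le

lemma scoringPayoff_sub_le_sellerValue (hπ : π₁ ∈ stdSimplex ℝ (Fin n))
    (hexcl : ∀ x < xs, π₁ x = 0) (hβ : (menu hw h).IsBuyerResponse E D.action π₁ β) :
    E.scoringPayoff xs w L ε xs - ε ^ 2 ≤ (menu hw h).sellerValue E β xs (D.action xs) := by
  have hterm : ∀ k, w k * (E.margin xs xs k - ε ^ 2) ≤
      w k * (E.saleGain xs (E.v₂₁ xs + E.v₂₂ k) (fun y => β y k) -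
        ε ^ 2 * E.quantity fun y => β y k) := fun k => by
    rcases (hw.nonneg k).eq_or_lt with hk | hk
    · simp [← hk]
    have hsale := margin_le_saleGain (hw.margin_nonneg k hk) (fun y => (hβ.mem y k).1)
      fun y hy => hβ.eq_one y k (buyerSurplus_pos hπ hexcl hk hy)
    have hquantity := (E.quantity_mem_Icc fun y => hβ.mem y k).2
    exact mul_le_mul_of_nonneg_left
      (sub_le_sub hsale (mul_le_of_le_one_right (sq_nonneg ε) hquantity)) hk.le
  have hsum := mul_le_mul_of_nonneg_left (sum_le_sum fun k (_ : k ∈ univ) => hterm k)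
    (by positivity : 0 ≤ 1 + ε ^ 2)
  have hmass : (1 + ε ^ 2) * ∑ k, w k ≤ 1 := by
    linarith [h.size xs, (menu hw h).base_nonneg (D.action xs),
      mul_nonneg (mul_pos two_pos h.pos).le (sub_nonneg.2 (h.keepPayoff_le xs))]
  rw [sellerValue_menu le_rfl, scoringPayoff]
  simp only [mul_sub (w _) _ (ε ^ 2), sum_sub_distrib, ← sum_mul] at hsum
  linarith [mul_le_mul_of_nonneg_right hmass (sq_nonneg ε)]

lemma upsets_menu (hw : E.IsPriceMixture xs w) (h : D.IsSmall w L ε) {u : Fin n → ℝ}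
    (hlow : ∀ x < xs, E.scoringPayoff xs w L ε x < u x)
    (hu : u xs < E.scoringPayoff xs w L ε xs - ε ^ 2) :
    Upsets E u xs (menu hw h).mechanism where
  lower_lose π₁ hπ g hg x hx := by
    obtain ⟨β, hβ, hvalue⟩ := (menu_implements hw h).exists_isBuyerResponse hπ hg
    exact (hvalue x).trans_le (sellerValue_le_scoringPayoff hπ hβ hx) |>.trans_lt (hlow x hx)
  gain π₁ hπ hexcl g hg := by
    obtain ⟨β, hβ, hvalue⟩ := (menu_implements hw h).exists_isBuyerResponse hπ hg
    exact hu.trans_le ((scoringPayoff_sub_le_sellerValue hπ hexcl hβ).trans_eq (hvalue xs).symm)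
  nonempty π₁ hπ := (menu_implements hw h).BR_nonempty hπ

end Separation

end Environment

end Separation

section UpsettingMechanisms

lemma eventually_nhdsGT_lt_of_continuous {f : ℝ → ℝ} (hf : Continuous f) {a c : ℝ} (h : f a < c) :
    ∀ᶠ ε in 𝓝[>] a, f ε < c :=
  ((hf.tendsto a).mono_left nhdsWithin_le_nhds).eventually (gt_mem_nhds h)

lemma exists_scaling_of_lt {ι : Type*} [Finite ι] {N R : ℝ} (hN : 0 ≤ N) (hNR : N < R)
    {c : ι → ℝ} (hc : ∀ i, 0 < c i) :
    ∃ l ∈ Set.Ioo (0 : ℝ) 1, N < l * R ∧ ∀ i, l * (R + c i) < N + c i := by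
  have hR : 0 < R := hN.trans_lt hNR
  have hratio : N / R < 1 := (div_lt_one hR).2 hNR
  have habove : ∀ᶠ l in 𝓝[>] (N / R), N / R < l := eventually_mem_nhdsWithin
  have hbelow : ∀ᶠ l in 𝓝[>] (N / R), l < 1 :=
    eventually_nhdsGT_lt_of_continuous continuous_id hratio
  have hadd : ∀ᶠ l in 𝓝[>] (N / R), ∀ i, l * (R + c i) < N + c i :=
    eventually_all.2 fun i => eventually_nhdsGT_lt_of_continuous (by fun_prop) <| by
      rw [mul_add, div_mul_cancel₀ _ hR.ne']
      exact add_lt_add_right (mul_lt_of_lt_one_left (hc i) hratio) _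
  obtain ⟨l, hl, hl1, hlc⟩ := (habove.and (hbelow.and hadd)).exists
  exact ⟨l, ⟨(div_nonneg hN hR.le).trans_lt hl, hl1⟩, (div_lt_iff₀ hR).1 hl, hlc⟩

variable {n m : ℕ} {E : Environment n m} {xs : Fin n} {w : Fin m → ℝ} {u : Fin n → ℝ}

namespace Environment

lemma keepPayoff_strictMono (E : Environment n m) : StrictMono E.keepPayoff := fun x x' hx => by
  linarith [E.keepPayoff_sub x x', E.v₁₁_strictMono hx]

namespace Separation

lemma eventually_isSmall (D : E.Separation xs) (hw : ∑ k, w k < 1) {L : ℝ}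
    (hL : ∀ a, E.keepPayoff a ≤ L) : ∀ᶠ ε in 𝓝[>] (0 : ℝ), D.IsSmall w L ε := by
  have hpos : ∀ᶠ ε in 𝓝[>] (0 : ℝ), 0 < ε := eventually_mem_nhdsWithin
  have hsize : ∀ᶠ ε in 𝓝[>] (0 : ℝ), ∀ a,
      2 * ε * (L - E.keepPayoff a) + (1 + ε ^ 2) * ∑ k, w k < 1 :=
    eventually_all.2 fun a => eventually_nhdsGT_lt_of_continuous (by fun_prop) (by simpa using hw)
  have hgap : ∀ᶠ ε in 𝓝[>] (0 : ℝ), ∀ y k, y < k → ε ^ 2 < E.v₂₂ k - E.v₂₂ y :=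
    eventually_all.2 fun y => eventually_all.2 fun k => eventually_imp_distrib_left.2 fun hy =>
      eventually_nhdsGT_lt_of_continuous (by fun_prop)
        (by simpa using E.v₂₂_strictMono hy)
  have hscore : ∀ᶠ ε in 𝓝[>] (0 : ℝ), ∀ x x', D.report x' ≠ D.report x →
      ε * (1 + |E.v₂₁ (D.report x') - E.v₂₁ (D.report x)|) <
        (E.keepPayoff (D.report x') - E.keepPayoff x) ^ 2 -
          (E.keepPayoff (D.report x) - E.keepPayoff x) ^ 2 :=
    eventually_all.2 fun x => eventually_all.2 fun x' => eventually_imp_distrib_left.2 fun hne =>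
      eventually_nhdsGT_lt_of_continuous (by fun_prop)
        (by simpa using D.keepPayoff_sub_sq_lt x x' hne)
  filter_upwards [hpos, hsize, hgap, hscore] with ε hpos hsize hgap hscore
  refine ⟨hpos, hL, fun a => (hsize a).le, hgap, fun x x' hne => ?_⟩
  rw [sq, mul_assoc]
  exact mul_lt_mul_of_pos_left (hscore x x' hne) hpos

lemma exists_upsets (D : E.Separation xs) (hw : E.IsPriceMixture xs w)
    (hu : u xs < E.keepPayoff xs + ∑ k, w k * E.margin xs xs k)
    (hlow : ∀ x < xs, E.keepPayoff x + ∑ k, w k * E.margin xs x k < u x) :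
    ∃ G, Upsets E u xs G := by
  obtain ⟨L, hL⟩ := (Set.finite_range E.keepPayoff).bddAbove
  have hsmall := D.eventually_isSmall hw.sum_lt_one fun a => hL (Set.mem_range_self a)
  have hgain : ∀ᶠ ε in 𝓝[>] (0 : ℝ), ε ^ 2 - E.scoringPayoff xs w L ε xs < -u xs :=
    eventually_nhdsGT_lt_of_continuous (by unfold scoringPayoff; fun_prop)
      (by simpa [scoringPayoff] using hu)
  have hlose : ∀ᶠ ε in 𝓝[>] (0 : ℝ), ∀ x < xs, E.scoringPayoff xs w L ε x < u x :=
    eventually_all.2 fun x => eventually_imp_distrib_left.2 fun hx =>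
      eventually_nhdsGT_lt_of_continuous (by unfold scoringPayoff; fun_prop)
        (by simpa [scoringPayoff] using hlow x hx)
  obtain ⟨ε, hsmall, hgain, hlose⟩ := (hsmall.and (hgain.and hlose)).exists
  exact ⟨_, upsets_menu hw hsmall hlose (by linarith)⟩

/-- All seller types make the same report. -/
def pooling (h : (∀ x, xs ≤ x) ∨ ∀ x, x ≤ xs) : E.Separation xs where
  report _ := xs
  share _ _ := 1
  report_of_le _ _ := rfl
  report_le _ hx := hx
  le_report x' hx' := h.elim (fun hbot => absurd (hbot x') hx'.not_ge) id
  share_mem _ _ := ⟨zero_le_one, le_rfl⟩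
  share_self _ := rfl
  share_mul_saleGain_le _ _ _ _ _ _ := le_rfl
  keepPayoff_sub_sq_lt _ _ hne := absurd rfl hne

end Separation

lemma keepPayoff_max_sub_sq_lt (E : Environment n m) {xs x x' : Fin n}
    (hne : max x' xs ≠ max x xs) :
    (E.keepPayoff (max x xs) - E.keepPayoff x) ^ 2 <
      (E.keepPayoff (max x' xs) - E.keepPayoff x) ^ 2 := by
  rcases le_total xs x with hx | hx
  · rw [max_eq_left hx] at hne ⊢
    rw [sub_self, zero_pow two_ne_zero]
    exact even_two.pow_pos (sub_ne_zero.2 (E.keepPayoff_strictMono.injective.ne hne))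
  · rw [max_eq_right hx] at hne ⊢
    have hlt := E.keepPayoff_strictMono ((le_max_right x' xs).lt_of_ne' hne)
    exact pow_lt_pow_left₀ (sub_lt_sub_right hlt _)
      (sub_nonneg.2 (E.keepPayoff_strictMono.monotone hx)) two_ne_zero

lemma exists_shares_of_privateValues (hv : ∀ y, E.v₁₂ y = 0) (xs : Fin n) (k : Fin m) :
    ∃ ϑ : Fin n → ℝ, (∀ a, ϑ a ∈ Set.Icc (0 : ℝ) 1) ∧ ϑ xs = 1 ∧
      (0 ≤ E.margin xs xs k → ∀ x a, xs ≤ a →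
        ϑ a * (E.v₂₁ a + E.v₂₂ k - E.v₁₁ x) ≤
          ϑ (max x xs) * (E.v₂₁ (max x xs) + E.v₂₂ k - E.v₁₁ x)) := by
  by_cases hm : 0 ≤ E.margin xs xs k
  · obtain ⟨ϑ, hmem, hself, hle⟩ := exists_retentionShares (M := fun a => E.v₂₁ a + E.v₂₂ k)
      (E.v₂₁_mono.add_const _) E.v₁₁_strictMono.monotone
      (by simpa [hv] using valuation_le_of_margin_nonneg hm le_rfl)
    exact ⟨ϑ, hmem, hself, fun _ => hle⟩
  · exact ⟨fun _ => 1, fun _ => ⟨zero_le_one, le_rfl⟩, rfl, fun hm' => absurd hm' hm⟩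

lemma nonempty_separation_of_privateValues (hv : ∀ y, E.v₁₂ y = 0) (xs : Fin n) :
    Nonempty (E.Separation xs) := by
  choose ϑ hmem hself hle using exists_shares_of_privateValues hv xs
  have hgain : ∀ x c (β : Fin m → ℝ), E.saleGain x c β = (c - E.v₁₁ x) * E.quantity β := by
    intro x c β
    simp only [saleGain, quantity, hv, mul_sum]
    exact sum_congr rfl fun y _ => by ring
  refine ⟨⟨fun x => max x xs, ϑ, fun x hx => max_eq_right hx, fun x hx => (max_eq_left hx).le,
    fun _ _ x => le_max_left x xs, hmem, hself, fun k hm β hβ x x' => ?_,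
    fun x x' => E.keepPayoff_max_sub_sq_lt⟩⟩
  simp only [hgain, ← mul_assoc]
  exact mul_le_mul_of_nonneg_right (hle k hm x _ (le_max_right x' xs)) (quantity_mem_Icc hβ).1

lemma nonempty_separation (h : n = 2 ∨ ∀ y, E.v₁₂ y = 0) (xs : Fin n) :
    Nonempty (E.Separation xs) := by
  rcases h with rfl | hv
  · exact ⟨Separation.pooling (by decide +revert)⟩
  · exact nonempty_separation_of_privateValues hv xs

lemma exists_le_forall_margin_nonneg (E : Environment n m) (xs : Fin n) (hw : ∀ k, 0 ≤ w k) :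
    ∃ w' : Fin m → ℝ, (∀ k, 0 ≤ w' k) ∧ (∀ k, w' k ≤ w k) ∧
      (∀ k, 0 < w' k → 0 ≤ E.margin xs xs k) ∧
      ∑ k, w k * E.margin xs xs k ≤ ∑ k, w' k * E.margin xs xs k := by
  set gainful : Set (Fin m) := {k | 0 ≤ E.margin xs xs k}
  refine ⟨gainful.indicator w, Set.indicator_nonneg fun k _ => hw k,
    Set.indicator_le_self' fun k _ => hw k,
    fun k hk => of_not_not fun hm => hk.ne' (Set.indicator_of_notMem (s := gainful) hm w),
    sum_le_sum fun k _ => ?_⟩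
  by_cases hm : k ∈ gainful
  · rw [Set.indicator_of_mem hm]
  · rw [Set.indicator_of_notMem hm, zero_mul]
    exact mul_nonpos_of_nonneg_of_nonpos (hw k) (not_le.1 hm).le

-- Scaling down a mixture that is profitable for `xs` until it barely improves on `N` lowers the
-- quantity that it sells, and the lower types value the good less than `xs`.
lemma exists_isPriceMixture (hw : ∀ k, 0 ≤ w k) (hw1 : ∑ k, w k ≤ 1) {N : ℝ} (hN : 0 ≤ N)
    (hgain : N < ∑ k, w k * E.margin xs xs k) :
    ∃ w', E.IsPriceMixture xs w' ∧ N < ∑ k, w' k * E.margin xs xs k ∧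
      ∀ x < xs, ∑ k, w' k * E.margin xs x k <
        N + (E.v₁₁ xs - E.v₁₁ x) * ∑ k, w k * E.tail k := by
  obtain ⟨w', hw'0, hw'w, hmargin, hle⟩ := exists_le_forall_margin_nonneg E xs hw
  have hNR := hgain.trans_le hle
  have htail : 0 < ∑ k, w' k * E.tail k := by
    obtain ⟨k, -, hk⟩ := exists_ne_zero_of_sum_ne_zero (hN.trans_lt hNR).ne'
    exact sum_pos' (fun k _ => mul_nonneg (hw'0 k) (E.tail_pos k).le)
      ⟨k, mem_univ k, mul_pos ((hw'0 k).lt_of_ne' (left_ne_zero_of_mul hk)) (E.tail_pos k)⟩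
  obtain ⟨l, ⟨hl0, hl1⟩, hlN, hlow⟩ := exists_scaling_of_lt hN hNR
    (c := fun x : Set.Iio xs => (E.v₁₁ xs - E.v₁₁ x) * ∑ k, w' k * E.tail k)
    fun x => mul_pos (sub_pos.2 (E.v₁₁_strictMono x.2)) htail
  have hscale : ∀ x, ∑ k, l * w' k * E.margin xs x k = l * ∑ k, w' k * E.margin xs x k := by
    simp only [mul_assoc, mul_sum, implies_true]
  refine ⟨fun k => l * w' k, ⟨fun k => mul_nonneg hl0.le (hw'0 k), ?_, fun k hk => ?_⟩, ?_,
    fun x hx => ?_⟩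
  · rw [← mul_sum]
    exact (mul_le_of_le_one_right hl0.le ((sum_le_sum fun k _ => hw'w k).trans hw1)).trans_lt hl1
  · exact hmargin k (pos_of_mul_pos_right hk hl0.le)
  · rwa [hscale]
  · rw [hscale, sum_mul_margin]
    refine (hlow ⟨x, hx⟩).trans_le (add_le_add_right ?_ N)
    exact mul_le_mul_of_nonneg_left
      (sum_le_sum fun k _ => mul_le_mul_of_nonneg_right (hw'w k) (E.tail_pos k).le)
      (sub_nonneg.2 (E.v₁₁_strictMono hx).le)

lemma exists_upsets (h : n = 2 ∨ ∀ y, E.v₁₂ y = 0) (hw : ∀ k, 0 ≤ w k) (hw1 : ∑ k, w k ≤ 1)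
    (hkeep : E.keepPayoff xs ≤ u xs) (hu : u xs < E.keepPayoff xs + ∑ k, w k * E.margin xs xs k)
    (hlow : ∀ x < xs, u xs - E.keepPayoff xs + (E.v₁₁ xs - E.v₁₁ x) * ∑ k, w k * E.tail k ≤
      u x - E.keepPayoff x) :
    ∃ G, Upsets E u xs G := by
  obtain ⟨D⟩ := nonempty_separation h xs
  obtain ⟨w', hw', hgain, hlose⟩ :=
    exists_isPriceMixture hw hw1 (sub_nonneg.2 hkeep) (sub_lt_iff_lt_add'.2 hu)
  exact D.exists_upsets hw' (by linarith) fun x hx => by linarith [hlose x hx, hlow x hx]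

lemma IsEquilibriumAllocation.postedPriceProof [MeasurableSpace Mechanism] {g : Allocation n m}
    (hg : E.IsEquilibriumAllocation g) (h : n = 2 ∨ ∀ y, E.v₁₂ y = 0)
    (hIC : E.PassesIntuitive g) : E.PostedPriceProof (E.sellerPayoff g) := by
  intro x q hq hmono hlow
  rw [← sum_increment_mul_margin]
  by_contra! hgain
  obtain ⟨G, hG⟩ := exists_upsets h (increment_nonneg (fun y => (hq y).1) hmono)
    (sum_increment_le_one fun y => (hq y).2) (hg.keepPayoff_le x) (sub_lt_iff_lt_add'.1 hgain)
    (by simpa only [sum_increment_mul_tail] using hlow)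
  exact hG.not_passesIntuitive hIC

end Environment

end UpsettingMechanisms

end InformedSeller

theorem theorem3 {n m : ℕ} [MeasurableSpace InformedSeller.Mechanism]
    (E : InformedSeller.Environment n m)
    (h : n = 2 ∨ ∀ y, E.v₁₂ y = 0)
    (g : InformedSeller.Allocation n m)
    (hg : E.IsEquilibriumAllocation g)
    (hIC : E.PassesIntuitive g) :
    (∃ gs : InformedSeller.Allocation n m, E.IsRSW gs) ∧
      ∀ gs : InformedSeller.Allocation n m, E.IsRSW gs →
        E.sellerPayoff g = E.sellerPayoff gs := by
  have hu := hg.postedPriceProof h hIC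
  obtain ⟨gs, hsafe, heq⟩ := hu.exists_safe hg.sellerBIC hg.buyerBIC hg.buyerBIR
  refine ⟨⟨gs, hsafe, fun x g' hg' => ?_⟩, fun g' hg' => funext fun x => le_antisymm ?_ ?_⟩
  · rw [heq]
    exact hu.sellerPayoff_le_of_safe hg' x
  · rw [← heq]
    exact hg'.2 x gs hsafe
  · exact hu.sellerPayoff_le_of_safe hg'.1 x
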